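/- There are a single deterministic algorithm and an absolute constant $C$ such that the following holds for every $n$ and all matroids $\mathcal M_1=(V,\mathcal I_1)$, $\mathcal M_2=(V,\mathcal I_2)$ on a common ground set $V=\{0,\dots,n-1\}$. Let $r$ be the maximum cardinality of a set in $\mathcal I_1\cap\mathcal I_2$. The algorithm is given $n$, and it can access the matroids only through independence oracles, which tell whether a queried set $S\subseteq V$ lies in $\mathcal I_1$, respectively in $\mathcal I_2$. It halts and outputs a set $S\in\mathcal I_1\cap\mathcal I_2$ with $|S|=r$, and 1. it makes at most $C\,nr\log r$ oracle queries; 2. its total running time is at most $C\,nr\log r\cdot\mathcal T_{\mathsf{ind}}$. Here $\mathcal T_{\mathsf{ind}}=T_1+T_2$, where $T_i\ge 0$ is the time that the oracle of $\mathcal M_i$ takes to answer a query, and it is only assumed that $\mathcal T_{\mathsf{ind}}\ge\max(r,1)$ (oracles have to read the sets they are asked about). In both bounds each of the factors $n$, $r$, $\log r$ is to be read as $\max(\cdot,1)$. Time is measured on a random access machine with arrays of natural numbers: every elementary step (reading or writing an array entry, successor, truncated subtraction, halving, comparison, test of a branch or loop) takes time $1$, and a query to oracle $i$ about the set listed in an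 initial segment of an array takes time $T_i$ in addition to the elementary steps spent on writing that list. -/

import Mathlib

/-! A random access machine with two independence oracles.

The memory consists of arrays of natural numbers: `σ a i` is entry `i` of array `a`.  A program is
one fixed finite text, so it names finitely many arrays; indices are computed at run time.
The elementary operations on numbers are successor, truncated difference, halving (rounding down)
and comparison.  Only the successor can produce a number larger than its arguments, and by one, so
after `t` steps every number is at most `c + n + t` with `c` the largest constant of the program:
words stay short and no computation can be hidden in the arithmetic of long numbers. -/

namespace OracleRAM

/-- Memory: array name, index, content. -/
abbrev Mem := ℕ → ℕ → ℕ

/-- Arithmetic expressions; `read a i` is the content of entry `i` of array `a`. -/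
inductive Expr : Type
  | const (c : ℕ) : Expr
  | read (a : ℕ) (i : Expr) : Expr
  | succ (e : Expr) : Expr
  | sub (e f : Expr) : Expr
  | half (e : Expr) : Expr
  | lt (e f : Expr) : Expr
  | eq (e f : Expr) : Expr

/-- The value of an expression; comparisons have value `1` (true) or `0` (false). -/
def Expr.eval (σ : Mem) : Expr → ℕ
  | const c => c
  | read a i => σ a (i.eval σ)
  | succ e => e.eval σ + 1
  | sub e f => e.eval σ - f.eval σ
  | half e => e.eval σ / 2
  | lt e f => if e.eval σ < f.eval σ then 1 else 0
  | eq e f => if e.eval σ = f.eval σ then 1 else 0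

/-- The number of elementary steps needed to evaluate an expression: one for each node. -/
def Expr.steps : Expr → ℕ
  | const _ => 1
  | read _ i => i.steps + 1
  | succ e => e.steps + 1
  | sub e f => e.steps + f.steps + 1
  | half e => e.steps + 1
  | lt e f => e.steps + f.steps + 1
  | eq e f => e.steps + f.steps + 1

/-- Programs. `write a i e` stores `e` in entry `i` of array `a`.
`query j a len b i` asks oracle `j` whether the set listed in the first `len` entries of array `a`
is independent, and stores the answer (`1` for yes, `0` for no) in entry `i` of array `b`.
Conditions hold if their value is not `0`. -/
inductive Cmd : Type
  | skip : Cmd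
  | write (a : ℕ) (i e : Expr) : Cmd
  | query (j : Fin 2) (a : ℕ) (len : Expr) (b : ℕ) (i : Expr) : Cmd
  | seq (c d : Cmd) : Cmd
  | branch (e : Expr) (c d : Cmd) : Cmd
  | loop (e : Expr) (c : Cmd) : Cmd

/-- Memory after storing `x` in entry `i` of array `a`. -/
def Mem.store (σ : Mem) (a i x : ℕ) : Mem :=
  fun a' i' => if a' = a ∧ i' = i then x else σ a' i'

/-- The subset of `{0, …, n - 1}` listed in the first `len` entries of array `a`. -/
def listed (n : ℕ) (σ : Mem) (a len : ℕ) : Set (Fin n) :=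
  {v | ∃ j < len, σ a j = (v : ℕ)}

open Classical in
/-- The answer of the independence oracle of `M` to the query `S`. -/
noncomputable def answer {n : ℕ} (M : Matroid (Fin n)) (S : Set (Fin n)) : ℕ :=
  if M.Indep S then 1 else 0

/-- What a run has spent: its number of elementary steps, and its numbers of queries to
oracle `0` and to oracle `1`. -/
abbrev Cost := ℕ × ℕ × ℕ

/-- The total number of queries. -/
def Cost.queries (k : Cost) : ℕ := k.2.1 + k.2.2

/-- The running time if a query to oracle `0` takes time `T₁`, one to oracle `1` takes time `T₂`,
and each elementary step takes time `1`. -/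
def Cost.time (k : Cost) (T₁ T₂ : ℝ) : ℝ := (k.1 : ℝ) + k.2.1 * T₁ + k.2.2 * T₂

/-- The cost of a single query: one query to oracle `j`, no elementary step. -/
def Cost.query (j : Fin 2) : Cost := if j = 0 then (0, 1, 0) else (0, 0, 1)

/-- `Exec M c σ σ' k`: with the independence oracles of `M 0` and `M 1`, the program `c`, started
in memory `σ`, halts in memory `σ'` and spends `k`. -/
inductive Exec {n : ℕ} (M : Fin 2 → Matroid (Fin n)) : Cmd → Mem → Mem → Cost → Prop
  | skip (σ : Mem) : Exec M .skip σ σ (1, 0, 0)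
  | write (σ : Mem) (a : ℕ) (i e : Expr) :
      Exec M (.write a i e) σ (σ.store a (i.eval σ) (e.eval σ)) (i.steps + e.steps + 1, 0, 0)
  | query (σ : Mem) (j : Fin 2) (a : ℕ) (len : Expr) (b : ℕ) (i : Expr) :
      Exec M (.query j a len b i) σ
        (σ.store b (i.eval σ) (answer (M j) (listed n σ a (len.eval σ))))
        ((len.steps + i.steps + 1, 0, 0) + Cost.query j)
  | seq {c d : Cmd} {σ σ' σ'' : Mem} {k l : Cost} :
      Exec M c σ σ' k → Exec M d σ' σ'' l → Exec M (.seq c d) σ σ'' (k + l)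
  | branch_true {e : Expr} {c d : Cmd} {σ σ' : Mem} {k : Cost} :
      e.eval σ ≠ 0 → Exec M c σ σ' k → Exec M (.branch e c d) σ σ' ((e.steps + 1, 0, 0) + k)
  | branch_false {e : Expr} {c d : Cmd} {σ σ' : Mem} {k : Cost} :
      e.eval σ = 0 → Exec M d σ σ' k → Exec M (.branch e c d) σ σ' ((e.steps + 1, 0, 0) + k)
  | loop_true {e : Expr} {c : Cmd} {σ σ' σ'' : Mem} {k l : Cost} :
      e.eval σ ≠ 0 → Exec M c σ σ' k → Exec M (.loop e c) σ' σ'' l →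
        Exec M (.loop e c) σ σ'' ((e.steps + 1, 0, 0) + k + l)
  | loop_false {e : Expr} {c : Cmd} {σ : Mem} :
      e.eval σ = 0 → Exec M (.loop e c) σ σ (e.steps + 1, 0, 0)

/-- The initial memory: the size `n` of the ground set, in entry `0` of array `0`, and zeros. -/
def input (n : ℕ) : Mem := fun a i => if a = 0 ∧ i = 0 then n else 0

/-- The output: the subset of `{0, …, n - 1}` whose indicator vector is held in array `1`. -/
def output (n : ℕ) (σ : Mem) : Set (Fin n) := {v | σ 1 (v : ℕ) ≠ 0}

end OracleRAM

/-- `n · r · log r`, where each factor is replaced by `1` if it is smaller than that. -/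
noncomputable def nrLogR (n r : ℕ) : ℝ := max (n : ℝ) 1 * max (r : ℝ) 1 * max (Real.log r) 1

/-! Starting from the empty set, a common independent set `S` is augmented along shortest paths of
the exchange graph, one breadth first search per augmentation. Both the correctness and the count
are carried by statements about closures of level sets rather than by the edges of the graph.

In round `k` an element `v` outside `S` is reached iff it is not in the `M₁`-closure of the elements
of `S` of level above `k`; one query decides this. If `S + v` is independent in `M₂`, the path ends
at `v`. Otherwise the still unreached elements of `S` on the `M₂`-circuit of `v` in `S + v` are
found by binary search until `v` is `M₂`-spanned by the levels up to `k + 1`. Each binary search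
costs `O(log p)` queries, `p = |S|`, and reaches a new element of `S`, so a whole breadth first
search pays for at most `p` of them; everything else is `O(n)` queries per round.

If `I` is common independent, then for each completed level every element is `M₁`-spanned by the
levels of `S` above `j` or `M₂`-spanned by those up to `j + 1`. Hence `|I| ≤ p + |level j + 1|`
(`Layered.ncard_le_ncard_add`). So an empty level proves `S` maximum, and otherwise every level has
at least `r - p` elements, which allows at most about `p / (r - p)` rounds (`Before.le_depth`).
Summed over `p` this is a harmonic sum, so there are `O(r log r)` rounds in total.

Augmentation runs backwards along the path (`Augmenting.step`). The level conditions replace the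
usual lemma that a path without shortcuts preserves independence.

The time bound follows because a query comes with `O(r)` elementary steps for writing its list, and
`r` is at most the time of the two oracles together. -/

open Set Function

/-! ### Exchange through closures of subsets of an independent set -/

namespace Matroid

variable {α : Type*} {M : Matroid α} {S X Y : Set α} {u v x : α}

/-- Closure commutes with intersection among subsets of one independent set. This takes the place of
uniqueness of fundamental circuits. -/
theorem Indep.mem_closure_inter (hS : M.Indep S) (hX : X ⊆ S) (hY : Y ⊆ S)
    (h₁ : v ∈ M.closure X) (h₂ : v ∈ M.closure Y) : v ∈ M.closure (X ∩ Y) := by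
  rw [(hS.subset (union_subset hX hY)).closure_inter_eq_inter_closure]
  exact ⟨h₁, h₂⟩

/-- If adding `u` to `X` closes a circuit through `v`, then `v` can be exchanged for `u`. -/
theorem Indep.notMem_closure_diff_of_insert (hS : M.Indep S) (hX : X ⊆ S) (hu : u ∈ S)
    (hv : v ∈ M.E) (hvS : v ∉ S) (h₁ : M.Indep (insert v X))
    (h₂ : ¬ M.Indep (insert v (insert u X))) : v ∉ M.closure (S \ {u}) := by
  intro h
  have hvX : v ∉ M.closure X :=
    ((hS.subset hX).notMem_closure_iff_of_notMem (fun h => hvS (hX h)) hv).2 h₁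
  have huX : insert u X ⊆ S := insert_subset hu hX
  have hvu : v ∈ M.closure (insert u X) := by
    by_contra hc
    exact h₂ (((hS.subset huX).notMem_closure_iff hv).1 hc).1
  refine hvX (M.closure_subset_closure ?_ (hS.mem_closure_inter huX sdiff_subset hvu h))
  rintro y ⟨rfl | hy, hy'⟩
  · exact absurd rfl hy'.2
  · exact hy

/-- If `v` were spanned by `S \ {u}` for every `u ∈ X \ Y`, it would be spanned by the intersection
of all these sets with `X`, which lies in `Y`. This is how an edge of the exchange graph leaving a
prescribed level is produced. -/
theorem Indep.exists_notMem_closure_diff (hS : M.Indep S) (hX : X ⊆ S)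
    (h₁ : v ∈ M.closure X) (h₂ : v ∉ M.closure Y) :
    ∃ u ∈ X \ Y, v ∉ M.closure (S \ {u}) := by
  by_contra! hc
  apply h₂
  have hne : (X \ Y).Nonempty := by
    by_contra he
    rw [not_nonempty_iff_eq_empty, sdiff_eq_empty] at he
    exact h₂ (M.closure_subset_closure he h₁)
  have : Nonempty (X \ Y : Set α) := hne.to_subtype
  have key := hS.closure_iInter_eq_biInter_closure_of_forall_subset
    (Js := fun u : (X \ Y : Set α) => S \ {u.1}) (fun u => sdiff_subset)
  have hv : v ∈ M.closure (⋂ u : (X \ Y : Set α), S \ {u.1}) := by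
    rw [key, mem_iInter]
    exact fun u => hc u.1 u.2
  refine M.closure_subset_closure ?_
    (hS.mem_closure_inter hX (iInter_subset_of_subset (Classical.arbitrary (X \ Y : Set α)) sdiff_subset)
      h₁ hv)
  rintro y ⟨hyX, hy⟩
  by_contra hyY
  have := mem_iInter.1 hy ⟨y, hyX, hyY⟩
  exact this.2 rfl

theorem Indep.insert_indep_of_notMem_closure (hS : M.Indep S) (hv : v ∈ M.E)
    (h : v ∉ M.closure S) : M.Indep (insert v S) :=
  ((hS.notMem_closure_iff hv).1 h).1

/-- Weak duality of matroid intersection: the part of `I` inside a closure is bounded by the rank of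
the spanning set. -/
theorem Indep.ncard_le_of_subset_closure_union [Finite α] {M₁ M₂ : Matroid α} {I : Set α}
    (h₁ : M₁.Indep I) (h₂ : M₂.Indep I) (h : I ⊆ M₁.closure X ∪ M₂.closure Y) :
    I.ncard ≤ X.ncard + Y.ncard := by
  have bound : ∀ (M : Matroid α) (Z : Set α), M.Indep I →
      (I ∩ M.closure Z).ncard ≤ Z.ncard := by
    intro M Z hI
    have := (hI.subset (inter_subset_left (t := M.closure Z))).encard_le_eRk_of_subset
      inter_subset_right
    rw [eRk_closure_eq] at this
    have := this.trans (M.eRk_le_encard Z)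
    rwa [← (toFinite _).cast_ncard_eq, ← (toFinite Z).cast_ncard_eq, Nat.cast_le] at this
  calc I.ncard ≤ ((I ∩ M₁.closure X) ∪ (I ∩ M₂.closure Y)).ncard := by
        refine ncard_le_ncard ?_ (toFinite _)
        rw [← inter_union_distrib_left]
        exact subset_inter subset_rfl h
    _ ≤ _ := ncard_union_le _ _
    _ ≤ _ := add_le_add (bound M₁ X h₁) (bound M₂ Y h₂)

end Matroid

/-! ### Levels of the breadth first search and Cunningham's bound -/

/-- Breadth first search in the exchange graph of the common independent set `S`, in its round `k`,
after the elements below `t` have been examined.  Elements outside `S` reached in round `j` have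
level `j`, the elements of `S` reached from them have level `j + 1`, the others have level `N`.
The elements of `ex` need not be expanded. -/
structure Layered {n : ℕ} (N : ℕ) (M₁ M₂ : Matroid (Fin n)) (S : Set (Fin n)) (k t : ℕ)
    (ex : Set (Fin n)) (lev par : ℕ → ℕ) : Prop where
  lev_inside : ∀ u ∈ S, lev u = N ∨ (1 ≤ lev u ∧ lev u ≤ k + 1)
  lev_outside : ∀ v ∉ S, lev v = N ∨ lev v ≤ k
  reached : ∀ v ∉ S, lev v ≠ N → v ∉ M₁.closure {u | u ∈ S ∧ lev v < lev u}
  spanned : ∀ v ∉ S, ∀ j, j < k → j < lev v → v ∈ M₁.closure {u | u ∈ S ∧ j < lev u}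
  spanned_current : ∀ v ∉ S, (v : ℕ) < t → k < lev v → v ∈ M₁.closure {u | u ∈ S ∧ k < lev u}
  closed : ∀ v ∉ S, v ∉ ex → lev v ≠ N → v ∈ M₂.closure {u | u ∈ S ∧ lev u ≤ lev v + 1}
  parent : ∀ u ∈ S, lev u ≠ N →
    ∃ w : Fin n, par u = w ∧ w ∉ S ∧ lev w + 1 = lev u ∧ w ∉ M₂.closure (S \ {u})

namespace Layered

variable {n N : ℕ} {M₁ M₂ : Matroid (Fin n)} {S ex : Set (Fin n)} {k t : ℕ} {lev par : ℕ → ℕ}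

theorem init (hlev : ∀ v : Fin n, lev v = N) : Layered N M₁ M₂ S 0 0 ∅ lev par where
  lev_inside u _ := Or.inl (hlev u)
  lev_outside u _ := Or.inl (hlev u)
  reached v _ h := absurd (hlev v) h
  spanned _ _ _ h := absurd h (Nat.not_lt_zero _)
  spanned_current _ _ h := absurd h (Nat.not_lt_zero _)
  closed v _ _ h := absurd (hlev v) h
  parent v _ h := absurd (hlev v) h

theorem next (h : Layered N M₁ M₂ S k t ex lev par) (ht : n ≤ t) :
    Layered N M₁ M₂ S (k + 1) 0 ex lev par where
  lev_inside u hu := by have := h.lev_inside u hu; omega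
  lev_outside u hu := by have := h.lev_outside u hu; omega
  reached := h.reached
  spanned v hv j hj hjv := by
    rcases Nat.lt_succ_iff_lt_or_eq.1 hj with hj | rfl
    · exact h.spanned v hv j hj hjv
    · exact h.spanned_current v hv (v.2.trans_le ht) hjv
  spanned_current _ _ h := absurd h (Nat.not_lt_zero _)
  closed := h.closed
  parent := h.parent

theorem advance (h : Layered N M₁ M₂ S k t ex lev par)
    (ht : ∀ v : Fin n, (v : ℕ) = t → v ∉ S → k < lev v →
      v ∈ M₁.closure {u | u ∈ S ∧ k < lev u}) :
    Layered N M₁ M₂ S k (t + 1) ex lev par :=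
  { h with
    spanned_current := fun v hv hvt hk => by
      rcases Nat.lt_succ_iff_lt_or_eq.1 hvt with hj | hj
      · exact h.spanned_current v hv hj hk
      · exact ht v hj hv hk }

/-- Only an element outside `S` changes its level, so all level sets inside `S` are unchanged. The
one condition that `v` may violate is `closed`, and it is suspended for `v` by the exception set. -/
theorem reach (h : Layered N M₁ M₂ S k t ∅ lev par) {v : Fin n} (hv : v ∉ S) (hvN : lev v = N)
    (hN : k < N) (hvt : (v : ℕ) = t) (hcl : v ∉ M₁.closure {u | u ∈ S ∧ k < lev u}) :
    Layered N M₁ M₂ S k (t + 1) {v} (update lev v k) par := by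
  have hS : ∀ u ∈ S, update lev v k u = lev u := fun u hu =>
    update_of_ne (by rintro e; obtain rfl := Fin.ext e; exact hv hu) _ _
  have hgt : ∀ j, {u | u ∈ S ∧ j < update lev v k u} = {u | u ∈ S ∧ j < lev u} := fun j => by
    ext u; exact and_congr_right fun hu => by rw [hS u hu]
  have hle : ∀ j, {u | u ∈ S ∧ update lev v k u ≤ j} = {u | u ∈ S ∧ lev u ≤ j} := fun j => by
    ext u; exact and_congr_right fun hu => by rw [hS u hu]
  have hne : ∀ w : Fin n, w ≠ v → update lev v k w = lev w := fun w hw =>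
    update_of_ne (fun e => hw (Fin.val_injective e)) _ _
  refine ⟨fun u hu => ?_, fun w hw => ?_, fun w hw hwN => ?_, fun w hw j hj hjw => ?_,
    fun w hw hwt hkw => ?_, fun w hw hex hwN => ?_, fun u hu huN => ?_⟩
  · rw [hS u hu]; exact h.lev_inside u hu
  · by_cases e : w = v
    · subst e; simp
    · rw [hne w e]; exact h.lev_outside w hw
  · rw [hgt]
    by_cases e : w = v
    · subst e; simpa using hcl
    · rw [hne w e] at hwN ⊢; exact h.reached w hw hwN
  · rw [hgt]
    by_cases e : w = v
    · subst e; exact h.spanned w hw j hj (by omega)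
    · rw [hne w e] at hjw; exact h.spanned w hw j hj hjw
  · rw [hgt]
    by_cases e : w = v
    · subst e; simp at hkw
    · rw [hne w e] at hkw
      have : (w : ℕ) ≠ v := fun e' => e (Fin.val_injective e')
      exact h.spanned_current w hw (by omega) hkw
  · rw [hne w hex] at hwN ⊢
    rw [hle]
    exact h.closed w hw (by simp) hwN
  · rw [hS u hu] at huN ⊢
    obtain ⟨w, h1, h2, h3, h4⟩ := h.parent u hu huN
    refine ⟨w, h1, h2, ?_, h4⟩
    have hlo := h.lev_inside u hu
    rw [hne w (by rintro rfl; omega)]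
    exact h3

/-- The level of `u` drops from `N` to `k + 1`. The sets of level above `j ≤ k` do not notice this,
and the sets of bounded level that occur in `closed` can only grow. -/
theorem descend {x : Fin n} (h : Layered N M₁ M₂ S k t {x} lev par) (hx : x ∉ S) (hxk : lev x = k)
    (hN : k + 1 < N) {u : Fin n} (hu : u ∈ S) (huN : lev u = N)
    (hux : x ∉ M₂.closure (S \ {u})) :
    Layered N M₁ M₂ S k t {x} (update lev u (k + 1)) (update par u x) := by
  have hne : ∀ w : Fin n, w ≠ u → update lev u (k + 1) w = lev w := fun w hw =>
    update_of_ne (fun e => hw (Fin.val_injective e)) _ _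
  have hS : ∀ w ∉ S, update lev u (k + 1) w = lev w := fun w hw =>
    hne w (by rintro rfl; exact hw hu)
  have hgt : ∀ j ≤ k, {w | w ∈ S ∧ j < update lev u (k + 1) w} = {w | w ∈ S ∧ j < lev w} :=
    fun j hj => by
      ext w
      refine and_congr_right fun hw => ?_
      by_cases e : w = u
      · subst e; simp; omega
      · rw [hne w e]
  -- The second alternative never occurs in the use below, where `j` is the level of a reached
  -- element and so at most `k`.
  have hle : ∀ j, {w | w ∈ S ∧ lev w ≤ j + 1} ⊆ {w | w ∈ S ∧ update lev u (k + 1) w ≤ j + 1} ∨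
      k + 1 < N ∧ N ≤ j + 1 := fun j => by
    by_cases hj : N ≤ j + 1
    · exact Or.inr ⟨hN, hj⟩
    · left
      rintro w ⟨hw, hwj⟩
      refine ⟨hw, ?_⟩
      by_cases e : w = u
      · subst e; omega
      · rwa [hne w e]
  refine ⟨fun w hw => ?_, fun w hw => ?_, fun w hw hwN => ?_, fun w hw j hj hjw => ?_,
    fun w hw hwt hkw => ?_, fun w hw hex hwN => ?_, fun w hw hwN => ?_⟩
  · by_cases e : w = u
    · subst e; simp
    · rw [hne w e]; exact h.lev_inside w hw
  · rw [hS w hw]; exact h.lev_outside w hw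
  · rw [hS w hw] at hwN ⊢
    rw [hgt _ (by have := h.lev_outside w hw; omega)]
    exact h.reached w hw hwN
  · rw [hS w hw] at hjw
    rw [hgt _ hj.le]
    exact h.spanned w hw j hj hjw
  · rw [hS w hw] at hkw
    rw [hgt _ le_rfl]
    exact h.spanned_current w hw hwt hkw
  · rw [hS w hw] at hwN ⊢
    have := h.lev_outside w hw
    rcases hle (lev w) with hl | hl
    · exact M₂.closure_subset_closure hl (h.closed w hw hex hwN)
    · omega
  · by_cases e : w = u
    · subst e
      refine ⟨x, by simp, hx, ?_, hux⟩
      rw [hS x hx, hxk]; simp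
    · rw [hne w e] at hwN ⊢
      obtain ⟨y, h1, h2, h3, h4⟩ := h.parent w hw hwN
      refine ⟨y, ?_, h2, ?_, h4⟩
      · rw [update_of_ne (fun e' => e (Fin.val_injective e'))]; exact h1
      · rw [hS y h2]; exact h3

theorem finish {x : Fin n} (h : Layered N M₁ M₂ S k t {x} lev par) (hxk : lev x = k)
    (hcl : x ∈ M₂.closure {u | u ∈ S ∧ lev u ≤ k + 1}) :
    Layered N M₁ M₂ S k t ∅ lev par :=
  { h with
    closed := fun v hv _ hvN => by
      by_cases e : v = x
      · subst e; rwa [hxk]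
      · exact h.closed v hv e hvN }

/-- Cunningham's bound: completed levels are at least as large as the deficiency of `S`. -/
theorem ncard_le_ncard_add (h : Layered N M₁ M₂ S k t ∅ lev par) (hN : k < N)
    (hE₁ : M₁.E = univ) (hE₂ : M₂.E = univ)
    {I : Set (Fin n)} (h₁ : M₁.Indep I) (h₂ : M₂.Indep I) {j : ℕ} (hj : j < k) :
    I.ncard ≤ S.ncard + {u | u ∈ S ∧ lev u = j + 1}.ncard := by
  -- The dual certificate: the two spanning sets cover `S` and overlap exactly in level `j + 1`.
  have key : I ⊆ M₁.closure {u | u ∈ S ∧ j < lev u} ∪ M₂.closure {u | u ∈ S ∧ lev u ≤ j + 1} := by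
    intro x _
    by_cases hx : x ∈ S
    · by_cases hl : j < lev x
      · exact Or.inl (M₁.mem_closure_of_mem ⟨hx, hl⟩ (by simp [hE₁]))
      · exact Or.inr (M₂.mem_closure_of_mem ⟨hx, by omega⟩ (by simp [hE₂]))
    · by_cases hl : j < lev x
      · exact Or.inl (h.spanned x hx j hj hl)
      · refine Or.inr (M₂.closure_subset_closure ?_ (h.closed x hx (by simp) (by omega)))
        rintro u ⟨hu, hul⟩
        exact ⟨hu, by omega⟩
  have hsplit : {u | u ∈ S ∧ lev u ≤ j} ∪ {u | u ∈ S ∧ j < lev u} = S := by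
    ext u; simp only [mem_union, mem_ofPred_eq]
    constructor
    · rintro (h | h) <;> exact h.1
    · intro hu
      rcases le_or_gt (lev u) j with hl | hl
      · exact Or.inl ⟨hu, hl⟩
      · exact Or.inr ⟨hu, hl⟩
  have hsplit' : {u | u ∈ S ∧ lev u ≤ j + 1} =
      {u | u ∈ S ∧ lev u ≤ j} ∪ {u | u ∈ S ∧ lev u = j + 1} := by
    ext u; simp only [mem_union, mem_ofPred_eq]
    rw [← and_or_left]
    exact and_congr_right fun _ => by omega
  have hd : Disjoint {u : Fin n | u ∈ S ∧ lev u ≤ j} {u | u ∈ S ∧ j < lev u} := by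
    rw [disjoint_left]
    rintro u ⟨_, h⟩ ⟨_, h'⟩
    omega
  have hc := ncard_union_eq hd (toFinite _) (toFinite _)
  rw [hsplit] at hc
  have h1 := h₁.ncard_le_of_subset_closure_union h₂ key
  have h2 := ncard_union_le {u : Fin n | u ∈ S ∧ lev u ≤ j} {u | u ∈ S ∧ lev u = j + 1}
  rw [← hsplit'] at h2
  omega

/-- No level is skipped: the parent of an element of level `j + 2` is spanned in `M₁` by the levels
above `j` but not by those above `j + 1`, so level `j + 1` contains a predecessor. -/
theorem exists_lev_eq_of_le (h : Layered N M₁ M₂ S k t ex lev par) (h₁ : M₁.Indep S)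
    (hN : k + 1 < N) : ∀ {j : ℕ}, j ≤ k → (∃ u ∈ S, lev u = j + 1) →
      ∀ i ≤ j, ∃ u ∈ S, lev u = i + 1
  | 0, _, hu, i, hi => by obtain rfl : i = 0 := by omega
                          exact hu
  | j + 1, hj, ⟨u, hu, huj⟩, i, hi => by
    rcases Nat.le_succ_iff.1 hi with hi | rfl
    · obtain ⟨w, _, hw, hwu, _⟩ := h.parent u hu (by omega)
      obtain ⟨u', ⟨⟨hu', h3⟩, h4⟩, _⟩ := h₁.exists_notMem_closure_diff
        (X := {u | u ∈ S ∧ j < lev u}) (Y := {u | u ∈ S ∧ lev w < lev u}) (fun u hu => hu.1)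
        (h.spanned w hw j (by omega) (by omega)) (h.reached w hw (by omega))
      refine h.exists_lev_eq_of_le h₁ hN (by omega) ⟨u', hu', ?_⟩ i hi
      by_contra hne
      exact h4 ⟨hu', by omega⟩
    · exact ⟨u, hu, huj⟩

end Layered

theorem mul_le_ncard_of_levels {n : ℕ} {S : Set (Fin n)} {lev : ℕ → ℕ} {m : ℕ} :
    ∀ {k : ℕ}, (∀ j < k, m ≤ {u | u ∈ S ∧ lev u = j + 1}.ncard) →
      k * m ≤ {u | u ∈ S ∧ lev u ≤ k}.ncard
  | 0, _ => by simp
  | k + 1, h => by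
    have ih := mul_le_ncard_of_levels (k := k) fun j hj => h j (by omega)
    have hd : Disjoint {u : Fin n | u ∈ S ∧ lev u ≤ k} {u | u ∈ S ∧ lev u = k + 1} := by
      rw [disjoint_left]
      rintro u ⟨_, h⟩ ⟨_, h'⟩
      omega
    have hs : {u : Fin n | u ∈ S ∧ lev u ≤ k + 1} =
        {u | u ∈ S ∧ lev u ≤ k} ∪ {u | u ∈ S ∧ lev u = k + 1} := by
      ext u; simp only [mem_union, mem_ofPred_eq]
      rw [← and_or_left]
      exact and_congr_right fun _ => by omega
    rw [hs, ncard_union_eq hd (toFinite _) (toFinite _), add_mul, one_mul]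
    exact add_le_add ih (h k (by omega))

/-! ### Augmenting along a path, from its end to its start -/

/-- The set `T` obtained from `S` by exchanging along the part of a shortest augmenting path
from its end back to the element `x`. -/
structure Augmenting {n : ℕ} (M₁ M₂ : Matroid (Fin n)) (S : Set (Fin n)) (lev : ℕ → ℕ)
    (T : Set (Fin n)) (x : Fin n) : Prop where
  mem : x ∈ T
  notMem : x ∉ S
  indep_diff : M₁.Indep (T \ {x})
  indep : M₂.Indep T
  subset : ∀ u ∈ S, lev u ≤ lev x → u ∈ T
  spanned : ∀ y ∈ T, y ≠ x → y ∉ S → y ∈ M₁.closure {u | u ∈ S ∧ lev x < lev u}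
  ncard : T.ncard = S.ncard + 1

namespace Augmenting

variable {n N : ℕ} {M₁ M₂ : Matroid (Fin n)} {S ex T : Set (Fin n)} {k t : ℕ} {lev par : ℕ → ℕ}
  {x : Fin n}

theorem start (h₁ : M₁.Indep S) (hx : x ∉ S) (h₂ : M₂.Indep (insert x S)) :
    Augmenting M₁ M₂ S lev (insert x S) x where
  mem := mem_insert _ _
  notMem := hx
  indep_diff := by simpa [hx] using h₁
  indep := h₂
  subset u hu _ := mem_insert_of_mem _ hu
  spanned y hy hyx hyS := by rcases hy with rfl | hy <;> contradiction
  ncard := ncard_insert_of_notMem hx (toFinite _)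

/-- Elements of `S` have positive level, so at level `0` the condition `reached` says that `S` does
not span `x` in `M₁`, whereas `S` spans the rest of `T`. -/
theorem indep_of_lev_eq_zero (h : Augmenting M₁ M₂ S lev T x)
    (hL : Layered N M₁ M₂ S k t ex lev par) (hE₁ : M₁.E = univ) (hN : 0 < N)
    (hx : lev x = 0) : M₁.Indep T := by
  have h0 : x ∉ M₁.closure (T \ {x}) := by
    intro hc
    refine hL.reached x h.notMem (by omega) (M₁.closure_subset_closure_of_subset_closure ?_ hc)
    rintro y ⟨hy, hyx⟩
    by_cases hyS : y ∈ S
    · exact M₁.mem_closure_of_mem ⟨hyS, by have := hL.lev_inside y hyS; omega⟩ (by simp [hE₁])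
    · exact h.spanned y hy hyx hyS
  have := h.indep_diff.insert_indep_of_notMem_closure (by simp [hE₁]) h0
  rwa [insert_sdiff_singleton, insert_eq_of_mem h.mem] at this

/-- `x` is spanned in `M₁` by the levels from `lev x` on, but not by those above it. -/
theorem exists_predecessor (h : Augmenting M₁ M₂ S lev T x)
    (hL : Layered N M₁ M₂ S k t ex lev par) (h₁ : M₁.Indep S)
    (hxN : lev x ≠ N) (hx : lev x ≠ 0) :
    ∃ u ∈ S, lev u = lev x ∧ x ∉ M₁.closure (S \ {u}) := by
  have hk := hL.lev_outside x h.notMem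
  obtain ⟨u, ⟨hu, hu'⟩, hux⟩ := h₁.exists_notMem_closure_diff (X := {u | u ∈ S ∧ lev x - 1 < lev u})
    (Y := {u | u ∈ S ∧ lev x < lev u}) (fun u hu => hu.1)
    (hL.spanned x h.notMem _ (by omega) (by omega)) (hL.reached x h.notMem hxN)
  refine ⟨u, hu.1, ?_, hux⟩
  have h3 := hu.2
  by_contra hne
  exact hu' ⟨hu.1, by omega⟩

/-- For `M₂`: `y` is spanned by levels of `S` that still lie in `T`. Were it also spanned by `T \
{u}`, then intersecting inside the independent set `T` would put it in the closure of `S \ {u}`,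
against the choice of parent. For `M₁`: apart from `x`, everything in `T \ {u}` is spanned by `S \
{u}`, because the new elements are spanned by levels above that of `u`; and `S \ {u}` does not span
`x`. -/
theorem step (h : Augmenting M₁ M₂ S lev T x)
    (hL : Layered N M₁ M₂ S k t ex lev par)
    (hex : ∀ w ∈ ex, lev w = k) (hE₁ : M₁.E = univ) (hE₂ : M₂.E = univ) {u y : Fin n}
    (hxk : lev x ≤ k) (hkN : k + 1 < N)
    (hu : u ∈ S) (hux : lev u = lev x) (hx : x ∉ M₁.closure (S \ {u}))
    (hy : par u = y) : y ∉ S ∧ lev y + 1 = lev x ∧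
      Augmenting M₁ M₂ S lev (insert y (T \ {u})) y := by
  have hlu := hL.lev_inside u hu
  obtain ⟨w, hw, hyS, hly, hyu⟩ := hL.parent u hu (by omega)
  obtain rfl : y = w := Fin.val_injective (hy ▸ hw)
  rw [hux] at hly
  have huT : u ∈ T := h.subset u hu hux.le
  have hyx : y ≠ x := by rintro rfl; omega
  have hyu' : y ≠ u := by rintro rfl; exact hyS hu
  have hxu : x ≠ u := by rintro rfl; exact h.notMem hu
  have hycl : y ∉ M₂.closure (T \ {u}) := by
    intro hc
    have h1 : y ∈ M₂.closure {u | u ∈ S ∧ lev u ≤ lev y + 1} :=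
      -- An element excepted from `closed` has level `k`, and `y` lies strictly below `lev x ≤ k`.
      hL.closed y hyS (fun hm => by have := hex y hm; omega) (by omega)
    refine hyu (M₂.closure_subset_closure ?_ (h.indep.mem_closure_inter
      (fun v hv => h.subset v hv.1 (by have := hv.2; omega)) sdiff_subset h1 hc))
    rintro v ⟨hv, hv'⟩
    exact ⟨hv.1, hv'.2⟩
  have hyT : y ∉ T := fun hyT => hycl (M₂.mem_closure_of_mem ⟨hyT, hyu'⟩ (by simp [hE₂]))
  refine ⟨hyS, hly, mem_insert _ _, hyS, ?_, ?_, ?_, ?_, ?_⟩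
  · have e : insert y (T \ {u}) \ {y} = insert x ((T \ {x}) \ {u}) := by
      ext v
      simp only [mem_sdiff, mem_insert_iff, mem_singleton_iff]
      constructor
      · rintro ⟨rfl | hv, hvy⟩
        · exact absurd rfl hvy
        · by_cases e : v = x
          · exact Or.inl e
          · exact Or.inr ⟨⟨hv.1, e⟩, hv.2⟩
      · rintro (rfl | hv)
        · exact ⟨Or.inr ⟨h.mem, hxu⟩, hyx.symm⟩
        · exact ⟨Or.inr ⟨hv.1.1, hv.2⟩, by rintro rfl; exact hyT hv.1.1⟩
    rw [e]
    refine (h.indep_diff.subset sdiff_subset).insert_indep_of_notMem_closure (by simp [hE₁]) ?_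
    intro hc
    refine hx (M₁.closure_subset_closure_of_subset_closure ?_ hc)
    rintro v ⟨⟨hv, hvx⟩, hvu⟩
    by_cases hvS : v ∈ S
    · exact M₁.mem_closure_of_mem ⟨hvS, hvu⟩ (by simp [hE₁])
    · refine M₁.closure_subset_closure ?_ (h.spanned v hv hvx hvS)
      rintro z ⟨hz, hz'⟩
      exact ⟨hz, by rintro rfl; omega⟩
  · exact (h.indep.subset sdiff_subset).insert_indep_of_notMem_closure (by simp [hE₂]) hycl
  · intro v hv hvy
    exact Or.inr ⟨h.subset v hv (by omega), by rintro rfl; omega⟩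
  · rintro v (rfl | ⟨hv, hvu⟩) hvy hvS
    · exact absurd rfl hvy
    · by_cases e : v = x
      · subst e
        exact hL.spanned v hvS _ (by omega) (by omega)
      · refine M₁.closure_subset_closure ?_ (h.spanned v hv e hvS)
        rintro z ⟨hz, hz'⟩
        exact ⟨hz, by omega⟩
  · rw [ncard_insert_of_notMem (fun h => hyT h.1) (toFinite _),
      ncard_sdiff_singleton_of_mem huT, h.ncard]
    omega

end Augmenting

/-! ### Reasoning about programs with credits -/

namespace OracleRAM

theorem Mem.store_same (σ : Mem) (a i x : ℕ) : σ.store a i x a = update (σ a) i x := by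
  ext j; simp [Mem.store, update_apply]

theorem Mem.store_ne (σ : Mem) {a b : ℕ} (i x : ℕ) (h : b ≠ a) : σ.store a i x b = σ b := by
  ext j; simp [Mem.store, h]

/-- The memories `σ` and `σ'` agree on all arrays that are not in `L`. -/
abbrev Same (L : List ℕ) (σ σ' : Mem) : Prop := ∀ a, a ∉ L → σ' a = σ a

theorem Same.store {L : List ℕ} {σ σ' : Mem} (h : Same L σ σ') {a : ℕ} (i x : ℕ) (ha : a ∈ L) :
    Same L σ (σ'.store a i x) := fun b hb => by
  rw [Mem.store_ne _ _ _ (show b ≠ a by rintro rfl; exact hb ha)]; exact h b hb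

theorem Same.trans {L L' : List ℕ} {σ σ' σ'' : Mem} (h : Same L σ σ') (h' : Same L' σ' σ'')
    (hL : L' ⊆ L) : Same L σ σ'' := fun b hb => by
  exact (h' b fun hb' => hb (hL hb')).trans (h b hb)

/-- With `U` credits, `c` halts in a memory that satisfies `Q m` with `m` the number of credits
left; a credit pays for `32 * (w + 1)` elementary steps and for `q` queries. -/
def Runs {n : ℕ} (M : Fin 2 → Matroid (Fin n)) (w q : ℕ) (c : Cmd) (σ : Mem) (U : ℕ)
    (Q : ℕ → Mem → Prop) : Prop :=
  ∃ σ' k m, Exec M c σ σ' k ∧ k.1 + 32 * (w + 1) * m ≤ 32 * (w + 1) * U ∧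
    k.2.1 + k.2.2 + q * m ≤ q * U ∧ m ≤ U ∧ Q m σ'

namespace Runs

variable {n : ℕ} {M : Fin 2 → Matroid (Fin n)} {w q U : ℕ} {c d : Cmd} {σ : Mem} {e : Expr}
  {Q R : ℕ → Mem → Prop}

theorem steps_le {s U : ℕ} (hs : s ≤ 32) (hU : 1 ≤ U) :
    s + 32 * (w + 1) * (U - 1) ≤ 32 * (w + 1) * U := by
  obtain ⟨U, rfl⟩ := Nat.exists_eq_add_of_le' hU
  rw [Nat.add_sub_cancel, mul_add _ U 1]
  nlinarith

theorem queries_le {U : ℕ} (hU : 1 ≤ U) : q + q * (U - 1) ≤ q * U := by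
  obtain ⟨U, rfl⟩ := Nat.exists_eq_add_of_le' hU
  rw [Nat.add_sub_cancel, mul_add _ U 1]
  omega

theorem skip (hU : 1 ≤ U) (hQ : Q (U - 1) σ) : Runs M w q .skip σ U Q :=
  ⟨_, _, U - 1, .skip σ, steps_le (by decide) hU, (by simpa using Nat.mul_le_mul_left q (by omega)),
    by omega, hQ⟩

theorem write {a : ℕ} {i : Expr} (hs : i.steps + e.steps + 1 ≤ 32) (hU : 1 ≤ U)
    (hQ : Q (U - 1) (σ.store a (i.eval σ) (e.eval σ))) : Runs M w q (.write a i e) σ U Q :=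
  ⟨_, _, U - 1, .write σ a i e, steps_le hs hU, (by simpa using Nat.mul_le_mul_left q (by omega)),
    by omega, hQ⟩

theorem seq (h : Runs M w q c σ U fun m σ' => Runs M w q d σ' m Q) :
    Runs M w q (.seq c d) σ U Q := by
  obtain ⟨σ', k, m, h1, h2, h3, h4, σ'', k', m', h1', h2', h3', h4', h5⟩ := h
  refine ⟨σ'', _, m', .seq h1 h1', ?_, ?_, h4'.trans h4, h5⟩
  · show k.1 + k'.1 + _ ≤ _; omega
  · show k.2.1 + k'.2.1 + (k.2.2 + k'.2.2) + _ ≤ _; omega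

theorem branch (hs : e.steps + 1 ≤ 32) (hU : 1 ≤ U)
    (h₁ : e.eval σ ≠ 0 → Runs M w q c σ (U - 1) Q) (h₂ : e.eval σ = 0 → Runs M w q d σ (U - 1) Q) :
    Runs M w q (.branch e c d) σ U Q := by
  have h6 := steps_le (w := w) hs hU
  have h7 := queries_le (q := q) hU
  by_cases he : e.eval σ = 0
  · obtain ⟨σ', k, m, h1, h2, h3, h4, h5⟩ := h₂ he
    refine ⟨σ', _, m, .branch_false he h1, ?_, ?_, by omega, h5⟩
    · show e.steps + 1 + k.1 + _ ≤ _; omega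
    · show 0 + k.2.1 + (0 + k.2.2) + _ ≤ _; omega
  · obtain ⟨σ', k, m, h1, h2, h3, h4, h5⟩ := h₁ he
    refine ⟨σ', _, m, .branch_true he h1, ?_, ?_, by omega, h5⟩
    · show e.steps + 1 + k.1 + _ ≤ _; omega
    · show 0 + k.2.1 + (0 + k.2.2) + _ ≤ _; omega

/-- Each test of the condition uses up a credit, so the number of credits is also the termination
measure. The invariant may depend on the credits left. -/
theorem loop (I : ℕ → Mem → Prop) (hs : e.steps + 1 ≤ 32) (hU : ∀ m σ, I m σ → 1 ≤ m)
    (body : ∀ m σ, I m σ → e.eval σ ≠ 0 → Runs M w q c σ (m - 1) I)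
    (exit : ∀ m σ, I m σ → e.eval σ = 0 → Q (m - 1) σ) (h : I U σ) :
    Runs M w q (.loop e c) σ U Q := by
  induction U using Nat.strong_induction_on generalizing σ with
  | _ U ih =>
    have h6 := steps_le (w := w) hs (hU _ _ h)
    have h7 := queries_le (q := q) (hU _ _ h)
    have h8 := hU _ _ h
    by_cases he : e.eval σ = 0
    · refine ⟨σ, _, U - 1, .loop_false he, h6, ?_, by omega, exit _ _ h he⟩
      show 0 + 0 + _ ≤ _; omega
    · obtain ⟨σ', k, m, h1, h2, h3, h4, h5⟩ := body _ _ h he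
      obtain ⟨σ'', k', m', h1', h2', h3', h4', h5'⟩ := ih m (by omega) h5
      refine ⟨σ'', _, m', .loop_true he h1 h1', ?_, ?_, by omega, h5'⟩
      · show e.steps + 1 + k.1 + k'.1 + _ ≤ _; omega
      · show 0 + k.2.1 + k'.2.1 + (0 + k.2.2 + k'.2.2) + _ ≤ _; omega

end Runs

/-- Entry `0` of array `a`, used as a variable. -/
abbrev var (a : ℕ) : Expr := .read a (.const 0)

/-- Assignment to the variable `a`. -/
abbrev assign (a : ℕ) (e : Expr) : Cmd := .write a (.const 0) e

/-! The arrays of the program: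
`0` size of the ground set; `1` indicator of the current set `S`; `2`, `3` list of the elements
of `S` and its length; `4` levels; `5` parents; `6`, `7` list of the elements to be queried and its
length; `8` answer of the oracle; `9` current element; `10` current round; `11` has an augmenting
path been found; `12` has an element been reached in this round; `13` index in the list;
`14`, `15`, `16` bounds and middle of the binary search; `17` end of the augmenting path;
`18` element of `S` to be exchanged; `19` index in the list.
-/

/-! ### Writing a query set and asking an oracle -/

/-- List the elements of array `2` whose index satisfies `keep` in array `6`. -/
def collect (keep : Expr) : Cmd :=
  .seq (assign 7 (.const 0)) <| .seq (assign 13 (.const 0)) <|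
  .loop (.lt (var 13) (var 3)) <|
    .seq (.branch keep
      (.seq (.write 6 (var 7) (.read 2 (var 13))) (assign 7 (.succ (var 7)))) .skip) <|
    assign 13 (.succ (var 13))

/-- Query oracle `j` on the elements of array `2` whose index satisfies `keep` and on `x`. -/
def ask (j : Fin 2) (keep x : Expr) : Cmd :=
  .seq (collect keep) <| .seq (.write 6 (var 7) x) <| .query j 6 (.succ (var 7)) 8 (.const 0)

variable {n : ℕ} {M : Fin 2 → Matroid (Fin n)}

theorem runs_collect {w q U : ℕ} {σ : Mem} {Q : ℕ → Mem → Prop} {keep : Expr} {K : ℕ → Prop}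
    (hs : keep.steps + 1 ≤ 32)
    (hK : ∀ σ' : Mem, (Same [6, 7, 13] σ σ') → (keep.eval σ' ≠ 0 ↔ K (σ' 13 0)))
    (hU : 5 * σ 3 0 + 3 ≤ U)
    (hQ : ∀ m σ', U ≤ m + (5 * σ 3 0 + 3) → (Same [6, 7, 13] σ σ') →
      (∀ y, (∃ j < σ' 7 0, σ' 6 j = y) ↔ ∃ i < σ 3 0, K i ∧ σ 2 i = y) → Q m σ') :
    Runs M w q (collect keep) σ U Q := by
  refine .seq (.write (by decide) (by omega) (.seq (.write (by decide) (by omega) ?_)))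
  refine .loop (fun m σ' => U ≤ m + (2 + 5 * σ' 13 0) ∧ σ' 13 0 ≤ σ 3 0 ∧
      (Same [6, 7, 13] σ σ') ∧
      (∀ y, (∃ j < σ' 7 0, σ' 6 j = y) ↔ ∃ i < σ' 13 0, K i ∧ σ 2 i = y))
    (by decide) ?_ ?_ ?_ ?_
  · rintro m σ' ⟨h1, h2, -, -⟩
    omega
  · rintro m σ' ⟨h1, h2, h3, h4⟩ h5
    have h33 : σ' 3 = σ 3 := h3 3 (by decide)
    have h32 : σ' 2 = σ 2 := h3 2 (by decide)
    have hlt : σ' 13 0 < σ 3 0 := by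
      by_contra hc
      simp [Expr.eval, h33, hc] at h5
    refine .seq (.branch hs (by omega) (fun hk => ?_) (fun hk => ?_))
    · refine .seq (.write (by decide) (by omega) (.write (by decide) (by omega)
        (.write (by decide) (by omega) ?_)))
      simp only [Expr.eval, Mem.store_same, Mem.store_ne, ne_eq,
        Nat.reduceEqDiff, not_false_eq_true, update_self]
      refine ⟨by omega, by omega, fun a ha => ?_, fun y => ?_⟩
      · simp only [List.mem_cons, List.not_mem_nil, or_false, not_or] at ha
        rw [Mem.store_ne _ _ _ ha.2.2, Mem.store_ne _ _ _ ha.2.1, Mem.store_ne _ _ _ ha.1]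
        exact h3 a (by simp [ha])
      · have hKi := (hK σ' h3).1 hk
        rw [h32]
        constructor
        · rintro ⟨j, hj, hjy⟩
          by_cases e : j = σ' 7 0
          · subst e
            rw [update_self] at hjy
            exact ⟨_, Nat.lt_succ_self _, hKi, hjy⟩
          · rw [update_of_ne e] at hjy
            obtain ⟨i, hi, h⟩ := (h4 y).1 ⟨j, by omega, hjy⟩
            exact ⟨i, by omega, h⟩
        · rintro ⟨i, hi, hi', hiy⟩
          by_cases e : i = σ' 13 0
          · exact ⟨σ' 7 0, by omega, by rw [update_self, ← e, hiy]⟩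
          · obtain ⟨j, hj, h⟩ := (h4 y).2 ⟨i, by omega, hi', hiy⟩
            exact ⟨j, by omega, by rwa [update_of_ne (by omega)]⟩
    · refine .skip (by omega) (.write (by decide) (by omega) ?_)
      simp only [Expr.eval, Mem.store_same, Mem.store_ne, ne_eq,
        Nat.reduceEqDiff, not_false_eq_true, update_self]
      refine ⟨by omega, by omega, fun a ha => ?_, fun y => ?_⟩
      · simp only [List.mem_cons, List.not_mem_nil, or_false, not_or] at ha
        rw [Mem.store_ne _ _ _ ha.2.2]
        exact h3 a (by simp [ha])
      · have hKi : ¬ K (σ' 13 0) := fun h => (hK σ' h3).2 h hk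
        rw [h4]
        constructor
        · rintro ⟨i, hi, h⟩
          exact ⟨i, by omega, h⟩
        · rintro ⟨i, hi, hi', hiy⟩
          have e : i ≠ σ' 13 0 := by rintro rfl; exact hKi hi'
          exact ⟨i, by omega, hi', hiy⟩
  · rintro m σ' ⟨h1, h2, h3, h4⟩ h5
    have h33 : σ' 3 = σ 3 := h3 3 (by decide)
    have hle : σ' 13 0 = σ 3 0 := by
      by_contra hc
      have : σ' 13 0 < σ 3 0 := by omega
      simp [Expr.eval, h33, this] at h5
    exact hQ _ _ (by omega) h3 (hle ▸ h4)
  · simp only [Expr.eval, Mem.store_same, Mem.store_ne, ne_eq,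
      Nat.reduceEqDiff, not_false_eq_true, update_self]
    refine ⟨by omega, by omega, fun a ha => ?_, fun y => ?_⟩
    · simp only [List.mem_cons, List.not_mem_nil, or_false, not_or] at ha
      rw [Mem.store_ne _ _ _ ha.2.2, Mem.store_ne _ _ _ ha.2.1]
    · simp

theorem answer_ne_zero {N : Matroid (Fin n)} {X : Set (Fin n)} : answer N X ≠ 0 ↔ N.Indep X := by
  simp [answer]

/-- A single credit pays for a query together with the writing of its list, since `w` bounds the
length of that list up to a factor. -/
theorem runs_ask {w U : ℕ} {σ : Mem} {Q : ℕ → Mem → Prop} {j : Fin 2} {keep x : Expr} {K : ℕ → Prop}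
    {y : ℕ} (hs : keep.steps + 1 ≤ 32) (hx : x.steps ≤ 29)
    (hK : ∀ σ' : Mem, (Same [6, 7, 13] σ σ') → (keep.eval σ' ≠ 0 ↔ K (σ' 13 0)))
    (hy : ∀ σ' : Mem, (Same [6, 7, 13] σ σ') → x.eval σ' = y)
    (hw : 5 * σ 3 0 + 4 ≤ w) (hU : 1 ≤ U)
    (hQ : ∀ σ', (Same [6, 7, 8, 13] σ σ') →
      (σ' 8 0 ≠ 0 ↔ (M j).Indep {v | (∃ i < σ 3 0, K i ∧ σ 2 i = v) ∨ y = v}) → Q (U - 1) σ') :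
    Runs M w 1 (ask j keep x) σ U Q := by
  -- Writing the list is counted in small credits, worth `32` steps and no query, which are then
  -- exchanged for one large credit.
  have h := runs_collect (M := M) (w := 0) (q := 0) (U := 5 * σ 3 0 + 3)
    (Q := fun _ σ' => (Same [6, 7, 13] σ σ') ∧
      (∀ y, (∃ j < σ' 7 0, σ' 6 j = y) ↔ ∃ i < σ 3 0, K i ∧ σ 2 i = y)) hs hK le_rfl
    (fun _ _ _ h1 h2 => ⟨h1, h2⟩)
  obtain ⟨σ', k, m, h1, h2, h3, h4, h5, h6⟩ := h
  have hxy := hy σ' h5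
  refine ⟨_, _, U - 1, .seq h1 (.seq (.write σ' 6 (var 7) x)
    (.query _ j 6 (.succ (var 7)) 8 (.const 0))), ?_, ?_, by omega, hQ _ (fun a ha => ?_) ?_⟩
  · have e : ∀ j : Fin 2, (Cost.query j).1 = 0 := by decide
    show k.1 + ((var 7).steps + x.steps + 1 +
      ((Expr.succ (var 7)).steps + (Expr.const 0).steps + 1 + (Cost.query j).1)) + _ ≤ _
    obtain ⟨U, rfl⟩ := Nat.exists_eq_add_of_le' hU
    simp only [Expr.steps, e, Nat.add_sub_cancel]
    nlinarith
  · have e : ∀ j : Fin 2, (Cost.query j).2.1 + (Cost.query j).2.2 = 1 := by decide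
    have := e j
    show k.2.1 + (0 + (0 + (Cost.query j).2.1)) + (k.2.2 + (0 + (0 + (Cost.query j).2.2))) + _ ≤ _
    omega
  · simp only [List.mem_cons, List.not_mem_nil, or_false, not_or] at ha
    rw [Mem.store_ne _ _ _ ha.2.2.1, Mem.store_ne _ _ _ ha.1]
    exact h5 a (by simp [ha])
  · simp only [Expr.eval, Mem.store_same, Mem.store_ne, ne_eq,
      Nat.reduceEqDiff, not_false_eq_true, update_self, hxy]
    rw [← ne_eq, answer_ne_zero]
    refine iff_of_eq (congrArg _ ?_)
    ext v
    simp only [listed, mem_ofPred_eq, Mem.store_same, ← h6]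
    constructor
    · rintro ⟨i, hi, hiv⟩
      by_cases e : i = σ' 7 0
      · subst e; right; simpa using hiv
      · left; rw [update_of_ne e] at hiv; exact ⟨i, by omega, hiv⟩
    · rintro (⟨i, hi, hiv⟩ | hv)
      · exact ⟨i, by omega, by rwa [update_of_ne (by omega)]⟩
      · exact ⟨σ' 7 0, by omega, by rwa [update_self]⟩

end OracleRAM

/-! ### Binary search and expansion of a reached element -/

namespace OracleRAM

variable {n : ℕ} {M : Fin 2 → Matroid (Fin n)} {w U R k t D : ℕ} {S : Set (Fin n)} {σ : Mem}
  {Q : ℕ → Mem → Prop} {x : Fin n}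

/-- Array `2` lists the elements of `S`. -/
structure Lists (S : Set (Fin n)) (σ : Mem) : Prop where
  size : σ 0 0 = n
  length : σ 3 0 = S.ncard
  mem : ∀ i < σ 3 0, ∃ v ∈ S, σ 2 i = v
  index : ∀ v ∈ S, ∃ i < σ 3 0, σ 2 i = v

theorem Lists.congr {σ' : Mem} (h : Lists S σ) (h0 : σ' 0 = σ 0) (h2 : σ' 2 = σ 2)
    (h3 : σ' 3 = σ 3) : Lists S σ' := by
  obtain ⟨a, b, c, d⟩ := h
  constructor
  · rwa [h0]
  · rwa [h3]
  · rwa [h3, h2]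
  · rwa [h3, h2]

theorem Lists.setOf_eq (h : Lists S σ) (P : ℕ → Prop) :
    {v : Fin n | (∃ i < σ 3 0, P (σ 2 i) ∧ σ 2 i = v) ∨ (x : ℕ) = v} =
      insert x {u | u ∈ S ∧ P u} := by
  ext v
  simp only [mem_ofPred_eq, mem_insert_iff, Fin.val_inj, eq_comm (a := x)]
  rw [or_comm]
  refine or_congr Iff.rfl ⟨?_, ?_⟩
  · rintro ⟨i, hi, hP, hv⟩
    obtain ⟨u, hu, hui⟩ := h.mem i hi
    obtain rfl : u = v := Fin.ext (hui ▸ hv)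
    exact ⟨hu, hv ▸ hP⟩
  · rintro ⟨hv, hP⟩
    obtain ⟨i, hi, hiv⟩ := h.index v hv
    exact ⟨i, hi, hiv ▸ hP, hiv⟩

/-- The elements of `S` among the first `i` of the list `l` or of level at most `k + 1`. -/
def initialPart (S : Set (Fin n)) (l lev : ℕ → ℕ) (k i : ℕ) : Set (Fin n) :=
  {u | u ∈ S ∧ ((∃ j < i, l j = u) ∨ lev u ≤ k + 1)}

theorem initialPart_zero {l lev : ℕ → ℕ} :
    initialPart S l lev k 0 = {u | u ∈ S ∧ lev u ≤ k + 1} := by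
  simp [initialPart]

theorem initialPart_length (h : Lists S σ) {lev : ℕ → ℕ} :
    initialPart S (σ 2) lev k (σ 3 0) = S := by
  ext u
  exact ⟨fun hu => hu.1, fun hu => ⟨hu, Or.inl (h.index u hu)⟩⟩

theorem initialPart_succ {l lev : ℕ → ℕ} {i : ℕ} {u : Fin n} (hu : u ∈ S) (hi : l i = u) :
    initialPart S l lev k (i + 1) = insert u (initialPart S l lev k i) := by
  ext v
  simp only [initialPart, mem_insert_iff, mem_ofPred_eq]
  constructor
  · rintro ⟨hv, ⟨j, hj, hjv⟩ | hl⟩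
    · rcases Nat.lt_succ_iff_lt_or_eq.1 hj with hj | rfl
      · exact Or.inr ⟨hv, Or.inl ⟨j, hj, hjv⟩⟩
      · exact Or.inl (Fin.ext (hjv ▸ hi))
    · exact Or.inr ⟨hv, Or.inr hl⟩
  · rintro (rfl | ⟨hv, ⟨j, hj, hjv⟩ | hl⟩)
    · exact ⟨hu, Or.inl ⟨i, by omega, hi⟩⟩
    · exact ⟨hv, Or.inl ⟨j, by omega, hjv⟩⟩
    · exact ⟨hv, Or.inr hl⟩

/-- The number of elements of `S` that have not been reached. -/
noncomputable def unreached (S : Set (Fin n)) (lev : ℕ → ℕ) : ℕ := {u | u ∈ S ∧ lev u = n + 3}.ncard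

theorem unreached_update {lev : ℕ → ℕ} {u : Fin n} (hu : u ∈ S) (hul : lev u = n + 3)
    (hk : k < n + 3) : unreached S (update lev u k) + 1 = unreached S lev := by
  have e : {v : Fin n | v ∈ S ∧ update lev u k v = n + 3} =
      {v | v ∈ S ∧ lev v = n + 3} \ {u} := by
    ext v
    by_cases e : v = u
    · subst e; simp; omega
    · have : (v : ℕ) ≠ u := fun e' => e (Fin.ext e')
      simp [e, update_of_ne this]
  have hm : u ∈ {v : Fin n | v ∈ S ∧ lev v = n + 3} := ⟨hu, hul⟩
  have hpos : 0 < {v : Fin n | v ∈ S ∧ lev v = n + 3}.ncard :=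
    (ncard_pos (toFinite _)).2 ⟨u, hm⟩
  rw [unreached, unreached, e, ncard_sdiff_singleton_of_mem hm]
  omega

theorem unreached_update_of_notMem {lev : ℕ → ℕ} {v : Fin n} (hv : v ∉ S) :
    unreached S (update lev v k) = unreached S lev := by
  unfold unreached
  congr 1
  ext u
  refine and_congr_right fun hu => ?_
  rw [update_of_ne]
  rintro e
  obtain rfl := Fin.ext e
  exact hv hu

/-- Ask oracle `1` about `initialPart` together with the current element. -/
def probe : Cmd :=
  -- Truncated subtraction from `1` is negation; the expression is a disjunction written by De
  -- Morgan's law.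
  ask 1 (.sub (.const 1) (.sub (.sub (.const 1) (.lt (var 13) (var 16)))
    (.lt (.read 4 (.read 2 (var 13))) (.succ (.succ (var 10)))))) (var 9)

theorem runs_probe (hL : Lists S σ) (hw : 5 * S.ncard + 4 ≤ w) (hx : σ 9 0 = x)
    (hi : σ 16 0 ≤ σ 3 0) (hU : 1 ≤ U)
    (hQ : ∀ σ', Same [6, 7, 8, 13] σ σ' →
      (σ' 8 0 ≠ 0 ↔ (M 1).Indep (insert x (initialPart S (σ 2) (σ 4) (σ 10 0) (σ 16 0)))) →
      Q (U - 1) σ') :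
    Runs M w 1 probe σ U Q := by
  refine runs_ask (K := fun i => i < σ 16 0 ∨ σ 4 (σ 2 i) ≤ σ 10 0 + 1) (y := x) (by decide)
    (by decide) (fun σ' h => ?_) (fun σ' h => ?_) (hL.length ▸ hw) hU (fun σ' h h' => hQ σ' h ?_)
  · simp only [Expr.eval, h 16 (by decide), h 4 (by decide), h 2 (by decide), h 10 (by decide)]
    split_ifs <;> simp <;> omega
  · simp only [Expr.eval, h 9 (by decide), hx]
  · rw [h']
    refine iff_of_eq (congrArg _ ?_)
    ext v
    simp only [initialPart, mem_ofPred_eq, mem_insert_iff, Fin.val_inj, eq_comm (a := x)]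
    rw [or_comm]
    refine or_congr Iff.rfl ⟨?_, ?_⟩
    · rintro ⟨i, hip, hK, hv⟩
      obtain ⟨u, hu, hui⟩ := hL.mem i hip
      obtain rfl : u = v := Fin.ext (hui ▸ hv)
      exact ⟨hu, hK.imp (fun hK => ⟨i, hK, hv⟩) (fun hK => hv ▸ hK)⟩
    · rintro ⟨hv, ⟨j, hj, hjv⟩ | hl⟩
      · exact ⟨j, by omega, Or.inl hj, hjv⟩
      · obtain ⟨i, hi, hiv⟩ := hL.index v hv
        exact ⟨i, hi, Or.inr (hiv ▸ hl), hiv⟩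

/-- Binary search for an element of `S` to which there is an edge from the current element. -/
def search : Cmd :=
  .seq (assign 14 (.const 0)) <| .seq (assign 15 (var 3)) <|
  .loop (.lt (.const 1) (.sub (var 15) (var 14))) <|
    -- The machine has no addition, so the middle is computed downwards from the upper bound.
    .seq (assign 16 (.sub (var 15) (.half (.sub (var 15) (var 14))))) <|
    .seq probe <|
    .branch (var 8) (assign 14 (var 16)) (assign 15 (var 16))

/-- The lower bound always gives an independent set and the upper bound a dependent one. The gap is
halved, rounding up, at five credits each time. -/
theorem runs_search (hL : Lists S σ) (hw : 5 * S.ncard + 4 ≤ w) (hx : σ 9 0 = x)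
    (h₁ : (M 1).Indep (insert x (initialPart S (σ 2) (σ 4) (σ 10 0) 0)))
    (h₂ : ¬ (M 1).Indep (insert x S)) (hU : 5 * Nat.clog 2 S.ncard + 3 + R ≤ U)
    (hQ : ∀ m σ', R ≤ m → Same [6, 7, 8, 13, 14, 15, 16] σ σ' → σ' 14 0 < σ 3 0 →
      (M 1).Indep (insert x (initialPart S (σ 2) (σ 4) (σ 10 0) (σ' 14 0))) →
      ¬ (M 1).Indep (insert x (initialPart S (σ 2) (σ 4) (σ 10 0) (σ' 14 0 + 1))) → Q m σ') :
    Runs M w 1 search σ U Q := by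
  refine .seq (.write (by decide) (by omega) (.seq (.write (by decide) (by omega) ?_)))
  have hpos : 0 < σ 3 0 := by
    by_contra hc
    have h0 : σ 3 0 = 0 := by omega
    rw [← h0, initialPart_length hL] at h₁
    exact h₂ h₁
  refine .loop (fun m σ' => 5 * Nat.clog 2 (σ' 15 0 - σ' 14 0) + 1 + R ≤ m ∧
    Same [6, 7, 8, 13, 14, 15, 16] σ σ' ∧ σ' 14 0 < σ' 15 0 ∧ σ' 15 0 ≤ σ 3 0 ∧
    (M 1).Indep (insert x (initialPart S (σ 2) (σ 4) (σ 10 0) (σ' 14 0))) ∧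
    ¬ (M 1).Indep (insert x (initialPart S (σ 2) (σ 4) (σ 10 0) (σ' 15 0)))) (by decide)
    ?_ ?_ ?_ ?_
  · rintro m σ' ⟨h, -⟩
    omega
  · rintro m σ' ⟨hm, hs, hlt, hle, hi, hd⟩ he
    have hgap : 1 < σ' 15 0 - σ' 14 0 := by
      by_contra hc
      simp [Expr.eval, hc] at he
    have hclog : Nat.clog 2 (σ' 15 0 - σ' 14 0) =
        Nat.clog 2 ((σ' 15 0 - σ' 14 0 + 1) / 2) + 1 := Nat.clog_of_two_le (by decide) hgap
    refine .seq (.write (by decide) (by omega) (.seq ?_))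
    have hs' := hs.store (a := 16) 0 (σ' 15 0 - (σ' 15 0 - σ' 14 0) / 2) (by decide)
    refine runs_probe (x := x)
      (hL.congr (hs' 0 (by decide)) (hs' 2 (by decide)) (hs' 3 (by decide))) hw ?_ ?_ (by omega) ?_
    · rw [← hx]; exact congrFun (hs' 9 (by decide)) 0
    · simp [Expr.eval, Mem.store_same, Mem.store_ne, hs 3 (by decide)]; omega
    · intro σ'' h h'
      have hs'' := hs'.trans h (by decide)
      simp only [Expr.eval, Mem.store_same, Mem.store_ne, ne_eq,
        Nat.reduceEqDiff, not_false_eq_true, update_self,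
        hs 2 (by decide), hs 4 (by decide), hs 10 (by decide)] at h'
      have e14 : σ'' 14 0 = σ' 14 0 := by rw [h 14 (by decide)]; simp [Mem.store_ne]
      have e15 : σ'' 15 0 = σ' 15 0 := by rw [h 15 (by decide)]; simp [Mem.store_ne]
      have e16 : σ'' 16 0 = σ' 15 0 - (σ' 15 0 - σ' 14 0) / 2 := by
        rw [h 16 (by decide)]; simp [Mem.store_same, Expr.eval]
      refine .branch (by decide) (by omega) (fun ha => .write (by decide) (by omega) ?_)
        (fun ha => .write (by decide) (by omega) ?_)
      · refine ⟨?_, hs''.store _ _ (by decide), ?_⟩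
        · simp only [Expr.eval, Mem.store_same, Mem.store_ne, ne_eq,
            Nat.reduceEqDiff, not_false_eq_true, update_self, e15, e16]
          have := Nat.clog_mono_right 2 (show σ' 15 0 - (σ' 15 0 - (σ' 15 0 - σ' 14 0) / 2) ≤
            (σ' 15 0 - σ' 14 0 + 1) / 2 by omega)
          omega
        · simp only [Expr.eval, Mem.store_same, Mem.store_ne, ne_eq,
            Nat.reduceEqDiff, not_false_eq_true, update_self, e15, e16]
          exact ⟨by omega, hle, h'.1 ha, hd⟩
      · refine ⟨?_, hs''.store _ _ (by decide), ?_⟩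
        · simp only [Expr.eval, Mem.store_same, Mem.store_ne, ne_eq,
            Nat.reduceEqDiff, not_false_eq_true, update_self, e14, e16]
          have := Nat.clog_mono_right 2 (show σ' 15 0 - (σ' 15 0 - σ' 14 0) / 2 - σ' 14 0 ≤
            (σ' 15 0 - σ' 14 0 + 1) / 2 by omega)
          omega
        · simp only [Expr.eval, Mem.store_same, Mem.store_ne, ne_eq,
            Nat.reduceEqDiff, not_false_eq_true, update_self, e14, e16]
          exact ⟨by omega, by omega, hi, fun hc => h'.2 hc ha⟩
  · rintro m σ' ⟨hm, hs, hlt, hle, hi, hd⟩ he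
    have hgap : σ' 14 0 + 1 = σ' 15 0 := by
      by_contra hc
      have : 1 < σ' 15 0 - σ' 14 0 := by omega
      simp [Expr.eval, this] at he
    exact hQ _ _ (by omega) hs (by omega) hi (hgap ▸ hd)
  · refine ⟨?_, Same.store (Same.store (fun _ _ => rfl) _ _ (by decide)) _ _ (by decide), ?_⟩
    · simp only [Expr.eval, Mem.store_same, Mem.store_ne, ne_eq,
        Nat.reduceEqDiff, not_false_eq_true, update_self, hL.length, Nat.sub_zero]
      omega
    · simp only [Expr.eval, Mem.store_same, Mem.store_ne, ne_eq,
        Nat.reduceEqDiff, not_false_eq_true, update_self]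
      rw [initialPart_length hL]
      exact ⟨hpos, le_rfl, h₁, h₂⟩

/-- Reach the elements of `S` to which there is an edge from the current element. -/
def expand : Cmd :=
  .seq (assign 16 (.const 0)) <| .seq probe <| .loop (var 8) <|
    .seq search <|
    .seq (assign 18 (.read 2 (var 14))) <|
    .seq (.write 4 (var 18) (.succ (var 10))) <|
    .seq (.write 5 (var 18) (var 9)) <|
    .seq (assign 12 (.const 1)) <|
    .seq (assign 16 (.const 0)) probe

/-- Amortization: each pass of the loop reaches a new element of `S`, and `5 * clog + 10` credits
have been set aside for every unreached one. The loop stops as soon as `x` is spanned in `M 1` by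
the levels up to `k + 1`, which is the condition `closed`. -/
theorem runs_expand (hE : ∀ j, (M j).E = univ) (hS : ∀ j, (M j).Indep S)
    (hL : Lists S σ) (hw : 5 * S.ncard + 4 ≤ w) (hx : σ 9 0 = x)
    (hxS : x ∉ S) (hk : σ 10 0 = k) (hkn : k ≤ n) (hxk : σ 4 x = k)
    (hlay : Layered (n + 3) (M 0) (M 1) S k t {x} (σ 4) (σ 5))
    (h₂ : ¬ (M 1).Indep (insert x S)) (hg : σ 12 0 ≠ 0 ↔ ∃ u ∈ S, σ 4 u = k + 1)
    (hU : (5 * Nat.clog 2 S.ncard + 10) * unreached S (σ 4) + 3 + R ≤ U)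
    (hQ : ∀ m σ', (5 * Nat.clog 2 S.ncard + 10) * unreached S (σ' 4) + R ≤ m →
      Same [4, 5, 6, 7, 8, 12, 13, 14, 15, 16, 18] σ σ' →
      Layered (n + 3) (M 0) (M 1) S k t ∅ (σ' 4) (σ' 5) →
      (σ' 12 0 ≠ 0 ↔ ∃ u ∈ S, σ' 4 u = k + 1) → Q m σ') :
    Runs M w 1 expand σ U Q := by
  refine .seq (.write (by decide) (by omega) (.seq ?_))
  have hs₀ : Same [4, 5, 6, 7, 8, 12, 13, 14, 15, 16, 18] σ (σ.store 16 0 0) :=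
    Same.store (fun _ _ => rfl) _ _ (by decide)
  refine runs_probe (x := x)
    (hL.congr (hs₀ 0 (by decide)) (hs₀ 2 (by decide)) (hs₀ 3 (by decide))) hw ?_ ?_ (by omega) ?_
  · rw [← hx]; exact congrFun (hs₀ 9 (by decide)) 0
  · simp [Expr.eval, Mem.store_same]
  intro σ₁ hs₁ ha₁
  have hs₁' := hs₀.trans hs₁ (by decide)
  refine .loop (fun m σ' => (5 * Nat.clog 2 S.ncard + 10) * unreached S (σ' 4) + 1 + R ≤ m ∧
    Same [4, 5, 6, 7, 8, 12, 13, 14, 15, 16, 18] σ σ' ∧ σ' 4 x = k ∧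
    Layered (n + 3) (M 0) (M 1) S k t {x} (σ' 4) (σ' 5) ∧
    (σ' 12 0 ≠ 0 ↔ ∃ u ∈ S, σ' 4 u = k + 1) ∧
    (σ' 8 0 ≠ 0 ↔ (M 1).Indep (insert x {u | u ∈ S ∧ σ' 4 u ≤ k + 1}))) (by decide) ?_ ?_ ?_ ?_
  · rintro m σ' ⟨h, -⟩
    omega
  · rintro m σ' ⟨hm, hs, hxk', hlay', hg', ha⟩ he
    have hL' := hL.congr (hs 0 (by decide)) (hs 2 (by decide)) (hs 3 (by decide))
    have hk' : σ' 10 0 = k := by rw [hs 10 (by decide), hk]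
    have hx' : σ' 9 0 = x := by rw [hs 9 (by decide), hx]
    have hi0 := ha.1 he
    have hex : ∃ u ∈ S, σ' 4 u = n + 3 := by
      by_contra! hc
      refine h₂ (hi0.subset (insert_subset_insert ?_))
      intro u hu
      have := hlay'.lev_inside u hu
      exact ⟨hu, this.resolve_left (hc u hu) |>.2⟩
    have hν : 1 ≤ unreached S (σ' 4) := by
      obtain ⟨u, hu⟩ := hex
      exact (ncard_pos (toFinite _)).2 ⟨u, hu⟩
    obtain ⟨ν, hν'⟩ := Nat.exists_eq_add_of_le' hν
    rw [hν', mul_add, mul_one] at hm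
    refine .seq (runs_search (x := x) (R := (5 * Nat.clog 2 S.ncard + 10) * ν + 7 + R) hL' hw hx' ?_
      h₂ (by omega) ?_)
    · rw [initialPart_zero, hk']; exact hi0
    intro m₁ σ₂ hm₁ hs₂ hlt hi hd
    rw [hk'] at hi hd
    obtain ⟨u, hu, hul⟩ := hL'.mem _ hlt
    rw [initialPart_succ hu hul] at hd
    -- An element already of level at most `k + 1` belongs to every initial part, so it cannot turn
    -- independence into dependence.
    have huN : σ' 4 u = n + 3 := by
      by_contra hc
      have hmem : u ∈ initialPart S (σ' 2) (σ' 4) k (σ₂ 14 0) :=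
        ⟨hu, Or.inr ((hlay'.lev_inside u hu).resolve_left hc).2⟩
      rw [insert_eq_of_mem hmem] at hd
      exact hd hi
    have hux : x ∉ (M 1).closure (S \ {u}) :=
      (hS 1).notMem_closure_diff_of_insert (fun v hv => hv.1) hu (by simp [hE]) hxS hi hd
    have hdesc := hlay'.descend hxS hxk' (by omega) hu huN hux
    have hunr := unreached_update (S := S) (lev := σ' 4) (k := k + 1) hu huN (by omega)
    have e2 := hs₂ 2 (by decide)
    have e4 := hs₂ 4 (by decide)
    have e5 := hs₂ 5 (by decide)
    have e9 := hs₂ 9 (by decide)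
    have e10 := hs₂ 10 (by decide)
    refine .seq (.write (by decide) (by omega) (.seq (.write (by decide) (by omega)
      (.seq (.write (by decide) (by omega) (.seq (.write (by decide) (by omega)
      (.seq (.write (by decide) (by omega) ?_)))))))))
    set σ₃ := Mem.store _ 16 _ _ with hσ₃
    have hs₃ : Same [4, 5, 6, 7, 8, 12, 13, 14, 15, 16, 18] σ σ₃ :=
      ((((((hs.trans hs₂ (by decide)).store _ _ (by decide)).store _ _ (by decide)).store _ _
        (by decide)).store _ _ (by decide)).store _ _ (by decide))
    have f4 : σ₃ 4 = update (σ' 4) u (k + 1) := by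
      simp [hσ₃, Expr.eval, Mem.store_same, Mem.store_ne, e2, e4, e10, hk', hul]
    have f5 : σ₃ 5 = update (σ' 5) u x := by
      simp [hσ₃, Expr.eval, Mem.store_same, Mem.store_ne, e2, e5, e9, hx', hul]
    have f12 : σ₃ 12 0 = 1 := by
      simp [hσ₃, Expr.eval, Mem.store_same, Mem.store_ne]
    have f16 : σ₃ 16 0 = 0 := by
      simp [hσ₃, Expr.eval, Mem.store_same]
    have f10 : σ₃ 10 0 = k := by rw [hs₃ 10 (by decide), hk]
    clear_value σ₃
    refine runs_probe (x := x)
      (hL.congr (hs₃ 0 (by decide)) (hs₃ 2 (by decide)) (hs₃ 3 (by decide))) hw ?_ ?_ (by omega) ?_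
    · rw [← hx]; exact congrFun (hs₃ 9 (by decide)) 0
    · omega
    intro σ₄ hs₄ ha₄
    rw [f10, f16, initialPart_zero, f4] at ha₄
    have g4 : σ₄ 4 = update (σ' 4) u (k + 1) := by rw [hs₄ 4 (by decide), f4]
    have g5 : σ₄ 5 = update (σ' 5) u x := by rw [hs₄ 5 (by decide), f5]
    refine ⟨?_, hs₃.trans hs₄ (by decide), ?_, ?_, ?_, ?_⟩
    · rw [g4, show unreached S (update (σ' 4) u (k + 1)) = ν by omega]
      omega
    · rw [g4, update_of_ne]
      · exact hxk'
      · intro e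
        obtain rfl := Fin.ext e
        exact hxS hu
    · rw [g4, g5]; exact hdesc
    · rw [hs₄ 12 (by decide), f12]
      exact ⟨fun _ => ⟨u, hu, by rw [g4, update_self]⟩, fun _ => one_ne_zero⟩
    · rw [g4]; exact ha₄
  · rintro m σ' ⟨hm, hs, hxk', hlay', hg', ha⟩ he
    refine hQ _ _ (by omega) hs (hlay'.finish hxk' ?_) hg'
    by_contra hc
    exact ha.2 (((hS 1).subset fun v hv => hv.1).insert_indep_of_notMem_closure
      (by simp [hE]) hc) he
  · have e4 : σ₁ 4 = σ 4 := by rw [hs₁ 4 (by decide)]; simp [Mem.store_ne]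
    have e5 : σ₁ 5 = σ 5 := by rw [hs₁ 5 (by decide)]; simp [Mem.store_ne]
    have e12 : σ₁ 12 = σ 12 := by rw [hs₁ 12 (by decide)]; simp [Mem.store_ne]
    refine ⟨by rw [e4]; omega, hs₁', by rw [e4, hxk], by rw [e4, e5]; exact hlay,
      by rw [e4, e12]; exact hg, ?_⟩
    rw [ha₁, e4]
    simp [Expr.eval, Mem.store_same, Mem.store_ne, hk, initialPart_zero]

end OracleRAM

/-! ### Rounds of the search and their number -/

namespace OracleRAM

variable {n : ℕ} {M : Fin 2 → Matroid (Fin n)} {w U R k t D : ℕ} {S : Set (Fin n)} {σ : Mem}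
  {Q : ℕ → Mem → Prop} {x : Fin n}

/-- The state of the search in round `k` after the elements below `t` have been examined. -/
structure Searching (M : Fin 2 → Matroid (Fin n)) (S : Set (Fin n)) (k t : ℕ) (σ : Mem) :
    Prop where
  lists : Lists S σ
  indicator : ∀ v : Fin n, σ 1 v ≠ 0 ↔ v ∈ S
  round : σ 10 0 = k
  flag : σ 11 0 = 0
  layered : Layered (n + 3) (M 0) (M 1) S k t ∅ (σ 4) (σ 5)
  progress : σ 12 0 ≠ 0 ↔ ∃ u ∈ S, σ 4 u = k + 1

/-- The search has found the end of a shortest augmenting path with at most `D` exchanges. -/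
structure Found (M : Fin 2 → Matroid (Fin n)) (S : Set (Fin n)) (D : ℕ) (σ : Mem) : Prop where
  lists : Lists S σ
  indicator : ∀ v : Fin n, σ 1 v ≠ 0 ↔ v ∈ S
  flag : σ 11 0 = 1
  target : ∃ (x : Fin n) (k t : ℕ), σ 17 0 = x ∧ x ∉ S ∧ k ≤ D ∧ σ 4 x = k ∧
    Layered (n + 3) (M 0) (M 1) S k t {x} (σ 4) (σ 5) ∧ (M 1).Indep (insert x S)

theorem Searching.congr {σ' : Mem} (h : Searching M S k t σ)
    (hs : Same [6, 7, 8, 9, 13, 14, 15, 16, 17, 18] σ σ') : Searching M S k t σ' := by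
  obtain ⟨h1, h2, h3, h4, h5, h6⟩ := h
  constructor
  · exact h1.congr (hs 0 (by decide)) (hs 2 (by decide)) (hs 3 (by decide))
  · rwa [hs 1 (by decide)]
  · rwa [hs 10 (by decide)]
  · rwa [hs 11 (by decide)]
  · rwa [hs 4 (by decide), hs 5 (by decide)]
  · rwa [hs 12 (by decide), hs 4 (by decide)]

theorem Found.congr {σ' : Mem} (h : Found M S D σ)
    (hs : Same [6, 7, 8, 9, 10, 12, 13, 14, 15, 16, 18] σ σ') : Found M S D σ' := by
  obtain ⟨h1, h2, h3, h4⟩ := h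
  constructor
  · exact h1.congr (hs 0 (by decide)) (hs 2 (by decide)) (hs 3 (by decide))
  · rwa [hs 1 (by decide)]
  · rwa [hs 11 (by decide)]
  · rwa [hs 17 (by decide), hs 4 (by decide), hs 5 (by decide)]

/-- Examine the current element. -/
def visit : Cmd :=
  .branch (.read 1 (var 9)) .skip <|
  .branch (.eq (.read 4 (var 9)) (.succ (.succ (.succ (var 0)))))
    (.seq (ask 0 (.lt (var 10) (.read 4 (.read 2 (var 13)))) (var 9)) <|
      .branch (var 8)
        (.seq (.write 4 (var 9) (var 10)) <|
          .seq (ask 1 (.const 1) (var 9)) <|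
          .branch (var 8) (.seq (assign 11 (.const 1)) (assign 17 (var 9))) expand)
        .skip)
    .skip

theorem runs_visit (hE : ∀ j, (M j).E = univ) (hS : ∀ j, (M j).Indep S)
    (hw : 5 * S.ncard + 4 ≤ w) (hkn : k ≤ n) (hkD : k ≤ D) (h : Searching M S k t σ) (ht : t < n)
    (h9 : σ 9 0 = t) (hU : (5 * Nat.clog 2 S.ncard + 10) * unreached S (σ 4) + 10 + R ≤ U)
    (hQ : ∀ m σ', σ' 9 0 = t →
      (Searching M S k (t + 1) σ' ∧ (5 * Nat.clog 2 S.ncard + 10) * unreached S (σ' 4) + R ≤ m) ∨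
        (Found M S D σ' ∧ R ≤ m) → Q m σ') :
    Runs M w 1 visit σ U Q := by
  obtain ⟨v, rfl⟩ : ∃ v : Fin n, (v : ℕ) = t := ⟨⟨t, ht⟩, rfl⟩
  refine .branch (by decide) (by omega) (fun h1 => .skip (by omega) ?_) (fun h1 => ?_)
  · have hv : v ∈ S := (h.indicator v).1 (by simpa [Expr.eval, h9] using h1)
    refine hQ _ _ h9 (Or.inl ⟨{ h with layered := h.layered.advance ?_ }, by omega⟩)
    intro v' e hv'
    obtain rfl := Fin.ext e
    exact absurd hv hv'
  have hv : v ∉ S := fun hv => (h.indicator v).2 hv (by simpa [Expr.eval, h9] using h1)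
  refine .branch (by decide) (by omega) (fun h2 => ?_) (fun h2 => .skip (by omega) ?_)
  swap
  · have hvN : σ 4 v ≠ n + 3 := by
      intro hc
      simp [Expr.eval, h9, hc, h.lists.size] at h2
    refine hQ _ _ h9 (Or.inl ⟨{ h with layered := h.layered.advance ?_ }, by omega⟩)
    intro v' e hv' hk
    obtain rfl := Fin.ext e
    have := h.layered.lev_outside _ hv'
    omega
  have hvN : σ 4 v = n + 3 := by
    by_contra hc
    simp [Expr.eval, h9, hc, h.lists.size] at h2
  refine .seq (runs_ask (K := fun i => k < σ 4 (σ 2 i)) (y := v) (by decide) (by decide)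
    (fun σ' hs => ?_) (fun σ' hs => ?_) (h.lists.length ▸ hw) (by omega) (fun σ₁ hs₁ ha₁ => ?_))
  · simp [Expr.eval, hs 10 (by decide), hs 4 (by decide), hs 2 (by decide), h.round]
  · simp [Expr.eval, hs 9 (by decide), h9]
  rw [h.lists.setOf_eq (fun y => k < σ 4 y)] at ha₁
  have hh₁ : Searching M S k v σ₁ :=
    h.congr (Same.trans (L := [6, 7, 8, 9, 13, 14, 15, 16, 17, 18]) (fun _ _ => rfl) hs₁
      (by decide))
  have e9 : σ₁ 9 0 = v := by rw [hs₁ 9 (by decide), h9]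
  have e4 : σ₁ 4 = σ 4 := hs₁ 4 (by decide)
  refine .branch (by decide) (by omega) (fun h3 => ?_) (fun h3 => .skip (by omega) ?_)
  swap
  · refine hQ _ _ e9 (Or.inl ⟨{ hh₁ with layered := hh₁.layered.advance ?_ }, by rw [e4]; omega⟩)
    intro v' e hv' hk
    obtain rfl := Fin.ext e
    rw [e4]
    by_contra hc
    exact ha₁.2 (((hS 0).subset fun v hv => hv.1).insert_indep_of_notMem_closure
      (by simp [hE]) hc) h3
  have hcl : v ∉ (M 0).closure {u | u ∈ S ∧ k < σ₁ 4 u} := by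
    rw [e4]
    exact (((hS 0).subset fun v hv => hv.1).notMem_closure_iff_of_notMem (fun hv' => hv hv'.1)
      (by simp [hE])).2 (ha₁.1 h3)
  have hlay := hh₁.layered.reach hv (by rw [e4, hvN]) (by omega) rfl hcl
  refine .seq (.write (by decide) (by omega) (.seq ?_))
  set σ₂ := Mem.store _ 4 _ _ with hσ₂
  have hs₂ : Same [4] σ₁ σ₂ := Same.store (fun _ _ => rfl) _ _ (by decide)
  have f4 : σ₂ 4 = update (σ₁ 4) v k := by
    simp [hσ₂, Expr.eval, Mem.store_same, e9, hh₁.round]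
  have hL₂ : Lists S σ₂ :=
    hh₁.lists.congr (hs₂ 0 (by decide)) (hs₂ 2 (by decide)) (hs₂ 3 (by decide))
  clear_value σ₂
  refine runs_ask (K := fun _ => True) (y := v) (by decide) (by decide)
    (fun σ' hs => by simp [Expr.eval])
    (fun σ' hs => by simp [Expr.eval, hs 9 (by decide), hs₂ 9 (by decide), e9])
    (hL₂.length ▸ hw) (by omega) (fun σ₃ hs₃ ha₃ => ?_)
  rw [hL₂.setOf_eq (fun _ => True)] at ha₃
  simp only [and_true, ofPred_mem_eq] at ha₃
  have hs₃' : Same [4, 6, 7, 8, 13] σ₁ σ₃ :=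
    Same.trans (Same.trans (fun _ _ => rfl) hs₂ (by decide)) hs₃ (by decide)
  have g4 : σ₃ 4 = update (σ₁ 4) v k := by rw [hs₃ 4 (by decide), f4]
  have g5 : σ₃ 5 = σ₁ 5 := hs₃' 5 (by decide)
  have g9 : σ₃ 9 0 = v := by rw [hs₃' 9 (by decide), e9]
  have hL₃ : Lists S σ₃ :=
    hL₂.congr (hs₃ 0 (by decide)) (hs₃ 2 (by decide)) (hs₃ 3 (by decide))
  have hlk : σ₃ 4 v = k := by rw [g4, update_self]
  rw [← g4, ← g5] at hlay
  refine .branch (by decide) (by omega) (fun h5 => ?_) (fun h5 => ?_)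
  · refine .seq (.write (by decide) (by omega) (.write (by decide) (by omega)
      (hQ _ _ ?_ (Or.inr ⟨⟨?_, ?_, ?_, v, k, v + 1, ?_, hv, hkD, ?_⟩, by omega⟩))))
    · simp [Expr.eval, Mem.store_ne, g9]
    · exact hL₃.congr (by simp [Mem.store_ne]) (by simp [Mem.store_ne]) (by simp [Mem.store_ne])
    · simpa [Mem.store_ne, hs₃' 1 (by decide)] using hh₁.indicator
    · simp [Expr.eval, Mem.store_ne, Mem.store_same]
    · simp [Expr.eval, Mem.store_ne, Mem.store_same, g9]
    · simp only [Expr.eval, Mem.store_ne, ne_eq, Nat.reduceEqDiff, not_false_eq_true]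
      exact ⟨hlk, hlay, ha₃.1 h5⟩
  · have hpr : ∀ u ∈ S, σ₃ 4 u = σ₁ 4 u := fun u hu => by
      rw [g4, update_of_ne]
      intro e
      obtain rfl := Fin.ext e
      exact hv hu
    refine runs_expand (k := k) (t := v + 1) (x := v) (R := R) hE hS hL₃ hw g9 hv ?_ hkn hlk hlay
      (fun hc => ha₃.2 hc h5) ?_ ?_ ?_
    · rw [hs₃' 10 (by decide), hh₁.round]
    · rw [hs₃' 12 (by decide), hh₁.progress]
      exact exists_congr fun u => and_congr_right fun hu => by rw [hpr u hu]
    · rw [g4, unreached_update_of_notMem hv, e4]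
      omega
    · intro m σ₄ hm hs₄ hlay₄ hg₄
      refine hQ _ _ ?_ (Or.inl ⟨⟨?_, ?_, ?_, ?_, hlay₄, hg₄⟩, hm⟩)
      · rw [hs₄ 9 (by decide), g9]
      · exact hL₃.congr (hs₄ 0 (by decide)) (hs₄ 2 (by decide)) (hs₄ 3 (by decide))
      · rw [hs₄ 1 (by decide), hs₃' 1 (by decide)]; exact hh₁.indicator
      · rw [hs₄ 10 (by decide), hs₃' 10 (by decide), hh₁.round]
      · rw [hs₄ 11 (by decide), hs₃' 11 (by decide), hh₁.flag]

/-- The state of the search before round `k`. -/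
structure Before (M : Fin 2 → Matroid (Fin n)) (S : Set (Fin n)) (k : ℕ) (σ : Mem) : Prop where
  lists : Lists S σ
  indicator : ∀ v : Fin n, σ 1 v ≠ 0 ↔ v ∈ S
  round : σ 10 0 = k
  flag : σ 11 0 = 0
  layered : Layered (n + 3) (M 0) (M 1) S k 0 ∅ (σ 4) (σ 5)
  lev_ne : ∀ u ∈ S, σ 4 u ≠ k + 1
  -- Array `12` starts with `1` so that round `0` is carried out although nothing has been reached
  -- before it.
  progress : σ 12 0 ≠ 0 ↔ k = 0 ∨ ∃ u ∈ S, σ 4 u = k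

/-- A round of the breadth first search. -/
def searchRound : Cmd :=
  .seq (assign 12 (.const 0)) <| .seq (assign 9 (.const 0)) <|
  -- Truncated subtraction of truth values means "and not": the scan stops once a path has been
  -- found.
  .seq (.loop (.sub (.lt (var 9) (var 0)) (var 11)) (.seq visit (assign 9 (.succ (var 9))))) <|
  assign 10 (.succ (var 10))

theorem runs_searchRound (hE : ∀ j, (M j).E = univ) (hS : ∀ j, (M j).Indep S)
    (hw : 5 * S.ncard + 4 ≤ w) (hkn : k ≤ n) (hkD : k ≤ D) (h : Before M S k σ)
    (hU : (5 * Nat.clog 2 S.ncard + 10) * unreached S (σ 4) + (12 * n + 4) + R ≤ U)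
    (hQ : ∀ m σ',
      (Before M S (k + 1) σ' ∧ (5 * Nat.clog 2 S.ncard + 10) * unreached S (σ' 4) + R ≤ m) ∨
        (Found M S D σ' ∧ R ≤ m) → Q m σ') :
    Runs M w 1 searchRound σ U Q := by
  refine .seq (.write (by decide) (by omega) (.seq (.write (by decide) (by omega) (.seq ?_))))
  refine .loop (fun m σ' =>
    (∃ t ≤ n, σ' 9 0 = t ∧ Searching M S k t σ' ∧
      (5 * Nat.clog 2 S.ncard + 10) * unreached S (σ' 4) + 12 * (n - t) + 2 + R ≤ m) ∨
    (Found M S D σ' ∧ 2 + R ≤ m)) (by decide) ?_ ?_ ?_ ?_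
  · rintro m σ' (⟨_, _, _, _, h⟩ | ⟨_, h⟩) <;> omega
  · rintro m σ' (⟨t, ht, h9, hs, hm⟩ | ⟨hf, hm⟩) he
    · have htn : t < n := by
        by_contra hc
        simp [Expr.eval, h9, hs.lists.size, hc] at he
      refine .seq (runs_visit (D := D) (R := 12 * (n - (t + 1)) + 3 + R) hE hS hw hkn hkD hs htn h9
        (by omega) (fun m₁ σ₁ e9 h₁ => .write (by decide) (by omega) ?_))
      rcases h₁ with ⟨h₁, hm₁⟩ | ⟨h₁, hm₁⟩
      · refine Or.inl ⟨t + 1, htn, ?_, h₁.congr (Same.store (fun _ _ => rfl) _ _ (by decide)), ?_⟩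
        · simp [Expr.eval, Mem.store_same, e9]
        · simp only [Mem.store_ne, ne_eq, Nat.reduceEqDiff, not_false_eq_true]
          omega
      · exact Or.inr ⟨h₁.congr (Same.store (fun _ _ => rfl) _ _ (by decide)), by omega⟩
    · exfalso
      revert he
      by_cases hlt : σ' 9 0 < σ' 0 0 <;> simp [Expr.eval, hf.flag, hlt]
  · rintro m σ' (⟨t, ht, h9, hs, hm⟩ | ⟨hf, hm⟩) he
    · have htn : t = n := by
        by_contra hc
        have : t < n := by omega
        simp [Expr.eval, h9, hs.lists.size, this, hs.flag] at he
      subst htn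
      refine .write (by decide) (by omega) (hQ _ _ (Or.inl ⟨?_, ?_⟩))
      · have hs' : ∀ x, Same [10] σ' (σ'.store 10 0 x) := fun x =>
          Same.store (fun _ _ => rfl) _ _ (by decide)
        constructor
        · exact hs.lists.congr (hs' _ 0 (by decide)) (hs' _ 2 (by decide)) (hs' _ 3 (by decide))
        · simpa [Mem.store_ne] using hs.indicator
        · simp [Expr.eval, Mem.store_same, hs.round]
        · simpa [Mem.store_ne] using hs.flag
        · simpa [Mem.store_ne] using hs.layered.next le_rfl
        · intro u hu
          have := hs.layered.lev_inside u hu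
          simp only [Mem.store_ne, ne_eq, Nat.reduceEqDiff, not_false_eq_true]
          omega
        · simpa [Mem.store_ne] using hs.progress
      · simp only [Mem.store_ne, ne_eq, Nat.reduceEqDiff, not_false_eq_true]
        omega
    · exact .write (by decide) (by omega) (hQ _ _ (Or.inr
        ⟨hf.congr (Same.store (fun _ _ => rfl) _ _ (by decide)), by omega⟩))
  · refine Or.inl ⟨0, by omega, by simp [Expr.eval, Mem.store_same], ?_, ?_⟩
    · constructor
      · exact h.lists.congr (by simp [Mem.store_ne]) (by simp [Mem.store_ne])
          (by simp [Mem.store_ne])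
      · simpa [Mem.store_ne] using h.indicator
      · simpa [Mem.store_ne] using h.round
      · simpa [Mem.store_ne] using h.flag
      · simpa [Mem.store_ne] using h.layered
      · simpa [Mem.store_ne, Mem.store_same, Expr.eval] using h.lev_ne
    · simp only [Mem.store_ne, ne_eq, Nat.reduceEqDiff, not_false_eq_true]
      omega

/-- A bound on the length of a shortest augmenting path for a common independent set of size `p`
if there is one of size `r`. -/
def depth (r p : ℕ) : ℕ := p / max (r - p) 1

theorem depth_le (r p : ℕ) : depth r p ≤ p := Nat.div_le_self _ _

/-- The levels `1, …, k` are disjoint parts of `S`. Each has at least `|I| - |S|` elements by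
Cunningham's bound, and at least one because no level is skipped; the latter matters when `S` is
already maximum. -/
theorem Before.le_depth {I : Set (Fin n)} (hE : ∀ j, (M j).E = univ) (hS : ∀ j, (M j).Indep S)
    (hI : ∀ j, (M j).Indep I) (h : Before M S k σ) (hk : k ≤ n + 1) (h12 : σ 12 0 ≠ 0) :
    k ≤ depth I.ncard S.ncard := by
  rw [depth, Nat.le_div_iff_mul_le (by omega)]
  refine (mul_le_ncard_of_levels (lev := σ 4) fun j hj => max_le ?_ ?_).trans
    (ncard_le_ncard (fun u hu => hu.1) (toFinite S))
  · have := h.layered.ncard_le_ncard_add (by omega) (hE 0) (hE 1) (hI 0) (hI 1) hj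
    omega
  · rcases h.progress.1 h12 with h0 | hu
    · omega
    · obtain ⟨k, rfl⟩ := Nat.exists_eq_succ_of_ne_zero (show k ≠ 0 by omega)
      obtain ⟨u, hu, huj⟩ := h.layered.exists_lev_eq_of_le (hS 0) (by omega) (by omega) hu j
        (by omega)
      exact (ncard_pos (toFinite _)).2 ⟨u, hu, huj⟩

/-- A round that reaches no element of `S` leaves an empty level, and Cunningham's bound becomes a
certificate of optimality. -/
theorem Before.ncard_le {I : Set (Fin n)} (hE : ∀ j, (M j).E = univ)
    (hI : ∀ j, (M j).Indep I) (h : Before M S k σ) (hk : k ≤ n + 1) (h12 : σ 12 0 = 0) :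
    I.ncard ≤ S.ncard := by
  have hp := mt h.progress.2 (by simpa using h12)
  push Not at hp
  obtain ⟨k, rfl⟩ := Nat.exists_eq_succ_of_ne_zero hp.1
  have := h.layered.ncard_le_ncard_add (by omega) (hE 0) (hE 1) (hI 0) (hI 1) (Nat.lt_succ_self k)
  have e : {u : Fin n | u ∈ S ∧ σ 4 u = k + 1} = ∅ := by
    ext u
    simp only [mem_ofPred_eq, mem_empty_iff_false, iff_false, not_and]
    exact hp.2 u
  rwa [e, ncard_empty] at this

/-- Breadth first search for a shortest augmenting path. -/
def breadthFirst : Cmd :=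
  .seq (assign 10 (.const 0)) <| .seq (assign 11 (.const 0)) <| .seq (assign 12 (.const 1)) <|
  .loop (.sub (.eq (var 11) (.const 0)) (.eq (var 12) (.const 0))) searchRound

theorem runs_breadthFirst {I : Set (Fin n)} (hE : ∀ j, (M j).E = univ) (hS : ∀ j, (M j).Indep S)
    (hI : ∀ j, (M j).Indep I) (hw : 5 * S.ncard + 4 ≤ w) (hL : Lists S σ)
    (hind : ∀ v : Fin n, σ 1 v ≠ 0 ↔ v ∈ S) (hlev : ∀ v : Fin n, σ 4 v = n + 3)
    (hU : (5 * Nat.clog 2 S.ncard + 10) * S.ncard +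
      (depth I.ncard S.ncard + 1) * (12 * n + 5) + 4 + R ≤ U)
    (hQ : ∀ m σ', R ≤ m → (Lists S σ' ∧ (∀ v : Fin n, σ' 1 v ≠ 0 ↔ v ∈ S) ∧ σ' 11 0 = 0 ∧
        I.ncard ≤ S.ncard) ∨ Found M S (depth I.ncard S.ncard) σ' → Q m σ') :
    Runs M w 1 breadthFirst σ U Q := by
  -- Rounds are numbered up to `D + 1 ≤ n + 1`, so genuine levels stay below the mark `n + 3` for
  -- unreached elements.
  have hSn : S.ncard ≤ n := by simpa using ncard_le_card S
  have hD := depth_le I.ncard S.ncard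
  set D := depth I.ncard S.ncard with hDdef
  refine .seq (.write (by decide) (by omega) (.seq (.write (by decide) (by omega)
    (.seq (.write (by decide) (by omega) ?_)))))
  refine .loop (fun m σ' =>
    (∃ k ≤ D + 1, Before M S k σ' ∧
      (5 * Nat.clog 2 S.ncard + 10) * unreached S (σ' 4) + (D + 1 - k) * (12 * n + 5) + 1 + R ≤ m) ∨
    (Found M S D σ' ∧ 1 + R ≤ m)) (by decide) ?_ ?_ ?_ ?_
  · rintro m σ' (⟨_, _, _, h⟩ | ⟨_, h⟩) <;> omega
  · rintro m σ' (⟨k, hk, hb, hm⟩ | ⟨hf, hm⟩) he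
    · have h12 : σ' 12 0 ≠ 0 := by
        intro hc
        simp [Expr.eval, hc, hb.flag] at he
      have hkD := hb.le_depth hE hS hI (by omega) h12
      rw [← hDdef] at hkD
      have e : (D + 1 - k) * (12 * n + 5) = (D + 1 - (k + 1)) * (12 * n + 5) + (12 * n + 5) := by
        rw [show D + 1 - k = (D + 1 - (k + 1)) + 1 by omega]
        ring
      refine runs_searchRound (D := D) (R := (D + 1 - (k + 1)) * (12 * n + 5) + 1 + R) hE hS hw
        (by omega) hkD hb (by omega) ?_
      rintro m₁ σ₁ (⟨h₁, hm₁⟩ | ⟨h₁, hm₁⟩)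
      · exact Or.inl ⟨k + 1, by omega, h₁, by omega⟩
      · exact Or.inr ⟨h₁, by omega⟩
    · exfalso
      revert he
      simp [Expr.eval, hf.flag]
  · rintro m σ' (⟨k, hk, hb, hm⟩ | ⟨hf, hm⟩) he
    · have h12 : σ' 12 0 = 0 := by
        by_contra hc
        simp [Expr.eval, hc, hb.flag] at he
      exact hQ _ _ (by omega) (Or.inl ⟨hb.lists, hb.indicator, hb.flag,
        hb.ncard_le hE hI (by omega) h12⟩)
    · exact hQ _ _ (by omega) (Or.inr hf)
  · refine Or.inl ⟨0, by omega, ⟨?_, ?_, ?_, ?_, ?_, ?_, ?_⟩, ?_⟩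
    · exact hL.congr (by simp [Mem.store_ne]) (by simp [Mem.store_ne]) (by simp [Mem.store_ne])
    · simpa [Mem.store_ne] using hind
    · simp [Expr.eval, Mem.store_ne, Mem.store_same]
    · simp [Expr.eval, Mem.store_ne, Mem.store_same]
    · exact Layered.init (by simpa [Mem.store_ne] using hlev)
    · simp [Mem.store_ne, hlev]
    · simp [Expr.eval, Mem.store_same]
    · have : unreached S (σ 4) ≤ S.ncard := ncard_le_ncard (fun u hu => hu.1) (toFinite S)
      have := Nat.mul_le_mul_left (5 * Nat.clog 2 S.ncard + 10) this
      simp only [Mem.store_ne, ne_eq, Nat.reduceEqDiff, not_false_eq_true, Nat.sub_zero]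
      omega

end OracleRAM

/-! ### Augmentation, phases and the main loop -/

namespace OracleRAM

variable {n : ℕ} {M : Fin 2 → Matroid (Fin n)} {w U R k t D : ℕ} {S T I : Set (Fin n)} {σ : Mem}
  {Q : ℕ → Mem → Prop} {x : Fin n}

/-- Find an element of `S` from which there is an edge to the current end of the path and whose
level is that of the end. -/
def predecessor : Cmd :=
  .seq (assign 19 (.const 0)) <|
  .loop (.lt (var 19) (var 3)) <|
    .seq (.branch (.eq (.read 4 (.read 2 (var 19))) (.read 4 (var 17)))
      (.seq (ask 0 (.sub (.const 1) (.eq (.read 2 (var 13)) (.read 2 (var 19)))) (var 17)) <|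
        .branch (var 8) (assign 18 (.read 2 (var 19))) .skip)
      .skip) <|
    assign 19 (.succ (var 19))

theorem runs_predecessor (hE : ∀ j, (M j).E = univ) (hS : ∀ j, (M j).Indep S)
    (hL : Lists S σ) (hw : 5 * S.ncard + 4 ≤ w) (hx : σ 17 0 = x) (hxS : x ∉ S)
    (hex : ∃ u ∈ S, σ 4 u = σ 4 x ∧ x ∉ (M 0).closure (S \ {u}))
    (hU : 6 * S.ncard + 2 + R ≤ U)
    (hQ : ∀ m σ', R ≤ m → Same [6, 7, 8, 13, 18, 19] σ σ' →
      (∃ u ∈ S, σ' 18 0 = u ∧ σ 4 u = σ 4 x ∧ x ∉ (M 0).closure (S \ {u})) → Q m σ') :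
    Runs M w 1 predecessor σ U Q := by
  set good : ℕ → Prop := fun y =>
    ∃ u ∈ S, y = u ∧ σ 4 u = σ 4 x ∧ x ∉ (M 0).closure (S \ {u}) with hgood
  refine .seq (.write (by decide) (by omega) ?_)
  -- Array `18` may hold a leftover value until the first good element is met, so the invariant
  -- promises a good value only once one has been scanned.
  refine .loop (fun m σ' => Same [6, 7, 8, 13, 18, 19] σ σ' ∧ σ' 19 0 ≤ S.ncard ∧
    6 * (S.ncard - σ' 19 0) + 1 + R ≤ m ∧ ∀ i < σ' 19 0, good (σ 2 i) → good (σ' 18 0))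
    (by decide) ?_ ?_ ?_ ?_
  · rintro m σ' ⟨_, _, h, _⟩; omega
  · rintro m σ' ⟨hs, hle, hm, hg⟩ he
    have hlt : σ' 19 0 < S.ncard := by
      by_contra hc
      simp [Expr.eval, hs 3 (by decide), hL.length, hc] at he
    obtain ⟨u, hu, hui⟩ := hL.mem (σ' 19 0) (hL.length ▸ hlt)
    have e2 := hs 2 (by decide)
    have e4 := hs 4 (by decide)
    have e17 : σ' 17 0 = x := by rw [hs 17 (by decide), hx]
    have skip_case : ∀ (m : ℕ) (σ'' : Mem), 6 * (S.ncard - σ' 19 0) + 1 + R ≤ m + 5 →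
        Same [6, 7, 8, 13] σ' σ'' → ¬ good u →
        Runs M w 1 (assign 19 (.succ (var 19))) σ'' m (fun m σ' =>
          Same [6, 7, 8, 13, 18, 19] σ σ' ∧ σ' 19 0 ≤ S.ncard ∧
          6 * (S.ncard - σ' 19 0) + 1 + R ≤ m ∧
          ∀ i < σ' 19 0, good (σ 2 i) → good (σ' 18 0)) := by
      intro m σ'' hm hs' hbad
      have f18 := hs' 18 (by decide)
      have f19 := hs' 19 (by decide)
      refine .write (by decide) (by omega)
        ⟨(hs.trans hs' (by decide)).store _ _ (by decide), ?_, ?_, ?_⟩ <;>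
      simp only [Expr.eval, Mem.store_same, Mem.store_ne, ne_eq, Nat.reduceEqDiff,
        not_false_eq_true, update_self, f18, f19]
      · omega
      · omega
      · intro i hi hgi
        rcases Nat.lt_succ_iff_lt_or_eq.1 hi with hi | rfl
        · exact hg i hi hgi
        · rw [hui] at hgi; exact absurd hgi hbad
    refine .seq (.branch (by decide) (by omega) (fun h1 => ?_) (fun h1 => .skip (by omega) ?_))
    swap
    · refine skip_case _ _ (by omega) (fun _ _ => rfl) ?_
      rintro ⟨u', _, huu, hl, _⟩
      obtain rfl := Fin.ext huu
      simp [Expr.eval, e2, e4, e17, hui, hl] at h1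
    have hul : σ 4 u = σ 4 x := by
      by_contra hc
      simp [Expr.eval, e2, e4, e17, hui, hc] at h1
    refine .seq (runs_ask (K := fun i => σ 2 i ≠ u) (y := x) (by decide) (by decide)
      (fun σ'' h => ?_) (fun σ'' h => ?_) ?_ (by omega) (fun σ₁ hs₁ ha₁ => ?_))
    · simp only [Expr.eval, h 2 (by decide), h 19 (by decide), e2, hui]
      split_ifs <;> simp_all
    · simp only [Expr.eval, h 17 (by decide), e17]
    · rw [hs 3 (by decide), hL.length]; exact hw
    have hset : insert x {v : Fin n | v ∈ S ∧ (v : ℕ) ≠ u} = insert x (S \ {u}) := by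
      congr 1
      ext v
      simp [Fin.val_inj]
    rw [hs 3 (by decide), e2, hL.setOf_eq (fun y => y ≠ u), hset] at ha₁
    have hSu : (M 0).Indep (S \ {u}) := (hS 0).subset sdiff_subset
    refine .branch (by decide) (by omega) (fun h2 => .write (by decide) (by omega)
      (.write (by decide) (by omega) ?_)) (fun h2 => .skip (by omega) ?_)
    · have hgu : good u := ⟨u, hu, rfl, hul,
        (hSu.notMem_closure_iff_of_notMem (fun h => hxS h.1) (by simp [hE])).2 (ha₁.1 h2)⟩
      have f19 := hs₁ 19 (by decide)
      have f2 := hs₁ 2 (by decide)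
      refine ⟨((hs.trans hs₁ (by decide)).store _ _ (by decide)).store _ _ (by decide),
        ?_, ?_, ?_⟩ <;>
      simp only [Expr.eval, Mem.store_same, Mem.store_ne, ne_eq, Nat.reduceEqDiff,
        not_false_eq_true, update_self, f19, f2, e2, hui]
      · omega
      · omega
      · exact fun _ _ _ => hgu
    · refine skip_case _ _ (by omega) hs₁ ?_
      rintro ⟨u', _, huu, _, hcl⟩
      obtain rfl := Fin.ext huu
      exact ha₁.2 (hSu.insert_indep_of_notMem_closure (by simp [hE]) hcl) h2
  · rintro m σ' ⟨hs, hle, hm, hg⟩ he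
    have hend : σ' 19 0 = S.ncard := by
      by_contra hc
      have : σ' 19 0 < S.ncard := by omega
      simp [Expr.eval, hs 3 (by decide), hL.length, this] at he
    obtain ⟨u, hu, hul, hux⟩ := hex
    obtain ⟨i, hi, hiu⟩ := hL.index u hu
    refine hQ _ _ (by omega) hs (hg i ?_ ⟨u, hu, hiu, hul, hux⟩)
    rw [hend, ← hL.length]; exact hi
  · refine ⟨Same.store (fun _ _ => rfl) _ _ (by decide), ?_, ?_, ?_⟩ <;>
    simp only [Expr.eval, Mem.store_same, update_self]
    · omega
    · omega
    · intro i hi; omega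

/-- Augment along the path found by the search. -/
def augment : Cmd :=
  .seq (.write 1 (var 17) (.const 1)) <|
  .loop (.read 4 (var 17)) <|
    .seq predecessor <|
    .seq (.write 1 (var 18) (.const 0)) <|
    .seq (assign 17 (.read 5 (var 18))) <|
    .write 1 (var 17) (.const 1)

theorem runs_augment (hE : ∀ j, (M j).E = univ) (hS : ∀ j, (M j).Indep S)
    (hw : 5 * S.ncard + 4 ≤ w) (hD : D ≤ n) (h : Found M S D σ)
    (hU : (6 * S.ncard + 6) * D + 2 + R ≤ U)
    (hQ : ∀ m σ', R ≤ m → σ' 0 0 = n → σ' 11 0 = 1 →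
      (∀ j, (M j).Indep (output n σ')) → (output n σ').ncard = S.ncard + 1 → Q m σ') :
    Runs M w 1 augment σ U Q := by
  obtain ⟨x₀, k, t, hx₀, hx₀S, hkD, hx₀k, hlay, hind⟩ := h.target
  have hex : ∀ w ∈ ({x₀} : Set (Fin n)), σ 4 w = k := by
    rintro w rfl; exact hx₀k
  refine .seq (.write (by decide) (by omega) ?_)
  refine .loop (fun m σ' => Same [1, 6, 7, 8, 13, 17, 18, 19] σ σ' ∧ ∃ x : Fin n, σ' 17 0 = x ∧
    σ 4 x ≤ k ∧ Augmenting (M 0) (M 1) S (σ 4) (output n σ') x ∧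
    (6 * S.ncard + 6) * σ 4 x + 1 + R ≤ m) (by decide) ?_ ?_ ?_ ?_
  · rintro m σ' ⟨_, x, _, _, _, h⟩; omega
  · rintro m σ' ⟨hs, x, hx, hxk, hA, hm⟩ he
    have e4 := hs 4 (by decide)
    have hx0 : σ 4 x ≠ 0 := by simpa [Expr.eval, hx, e4] using he
    obtain ⟨l, hl⟩ := Nat.exists_eq_succ_of_ne_zero hx0
    rw [hl, Nat.mul_succ] at hm
    refine .seq (runs_predecessor (x := x) (R := (6 * S.ncard + 6) * l + 4 + R) hE hS
      (h.lists.congr (hs 0 (by decide)) (hs 2 (by decide)) (hs 3 (by decide))) hw hx hA.notMem ?_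
      (by omega) ?_)
    · rw [e4]; exact hA.exists_predecessor hlay (hS 0) (by omega) hx0
    rintro m₁ σ₁ hm₁ hs₁ ⟨u, hu, h18, hul, hux⟩
    rw [e4] at hul
    obtain ⟨y, hy, -⟩ := hlay.parent u hu (by omega)
    obtain ⟨hyS, hyl, hA'⟩ := hA.step hlay hex (hE 0) (hE 1) hxk (by omega) hu hul hux hy
    have f5 : σ₁ 5 = σ 5 := by rw [hs₁ 5 (by decide), hs 5 (by decide)]
    refine .seq (.write (by decide) (by omega) (.seq (.write (by decide) (by omega)
      (.write (by decide) (by omega) ?_))))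
    refine ⟨(((hs.trans hs₁ (by decide)).store _ _ (by decide)).store _ _ (by decide)).store _ _
      (by decide), y, ?_, by omega, ?_, ?_⟩
    · simp [Expr.eval, Mem.store_same, Mem.store_ne, f5, h18, hy]
    · convert hA' using 1
      ext v
      have f1 := hs₁ 1 (by decide)
      simp only [output, Expr.eval, Mem.store_same, Mem.store_ne, ne_eq, Nat.reduceEqDiff,
        not_false_eq_true, update_self, f5, h18, hy, f1, mem_insert_iff, mem_sdiff, mem_ofPred_eq,
        mem_singleton_iff, OfNat.ofNat_ne_one]
      by_cases hvy : v = y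
      · subst hvy; simp
      · rw [update_of_ne (fun e => hvy (Fin.ext e))]
        by_cases hvu : v = u
        · subst hvu; simp [hvy]
        · rw [update_of_ne (fun e => hvu (Fin.ext e))]
          simp [hvy, hvu]
    · obtain rfl : σ 4 y = l := by omega
      omega
  · rintro m σ' ⟨hs, x, hx, hxk, hA, hm⟩ he
    have e4 := hs 4 (by decide)
    have hx0 : σ 4 x = 0 := by simpa [Expr.eval, hx, e4] using he
    refine hQ _ _ (by omega) ?_ ?_ ?_ hA.ncard
    · rw [hs 0 (by decide), h.lists.size]
    · rw [hs 11 (by decide), h.flag]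
    · rw [Fin.forall_fin_two]
      exact ⟨hA.indep_of_lev_eq_zero hlay (hE 0) (by omega) hx0, hA.indep⟩
  · refine ⟨Same.store (fun _ _ => rfl) _ _ (by decide), x₀, by simp [Mem.store_ne, hx₀],
      hx₀k.le, ?_, ?_⟩
    · have e : output n (σ.store 1 ((var 17).eval σ) ((Expr.const 1).eval σ)) = insert x₀ S := by
        ext v
        simp only [output, Expr.eval, Mem.store_same, hx₀, mem_ofPred_eq, mem_insert_iff]
        by_cases hv : v = x₀
        · subst hv; simp
        · rw [update_of_ne (fun e => hv (Fin.ext e))]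
          simp [hv, h.indicator]
      rw [e]
      exact Augmenting.start (hS 0) hx₀S hind
    · have := Nat.mul_le_mul_left (6 * S.ncard + 6) (hx₀k.le.trans hkD)
      omega

/-- List the elements of the current set and initialize the levels. -/
def gather : Cmd :=
  .seq (assign 3 (.const 0)) <| .seq (assign 9 (.const 0)) <|
  .loop (.lt (var 9) (var 0)) <|
    .seq (.branch (.read 1 (var 9))
      (.seq (.write 2 (var 3) (var 9)) (assign 3 (.succ (var 3)))) .skip) <|
    .seq (.write 4 (var 9) (.succ (.succ (.succ (var 0))))) <|
    assign 9 (.succ (var 9))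

theorem runs_gather {q : ℕ} (hσ : σ 0 0 = n) (hU : 6 * n + 3 + R ≤ U)
    (hQ : ∀ m σ', R ≤ m → Same [2, 3, 4, 9] σ σ' → Lists (output n σ) σ' →
      (∀ v : Fin n, σ' 4 v = n + 3) → Q m σ') :
    Runs M w q gather σ U Q := by
  set S := output n σ with hS
  refine .seq (.write (by decide) (by omega) (.seq (.write (by decide) (by omega) ?_)))
  refine .loop (fun m σ' => Same [2, 3, 4, 9] σ σ' ∧ σ' 9 0 ≤ n ∧
    6 * (n - σ' 9 0) + 1 + R ≤ m ∧ σ' 3 0 = {v : Fin n | v ∈ S ∧ (v : ℕ) < σ' 9 0}.ncard ∧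
    (∀ i < σ' 3 0, ∃ v ∈ S, σ' 2 i = v) ∧
    (∀ v ∈ S, (v : ℕ) < σ' 9 0 → ∃ i < σ' 3 0, σ' 2 i = v) ∧
    ∀ v : Fin n, (v : ℕ) < σ' 9 0 → σ' 4 v = n + 3) (by decide) ?_ ?_ ?_ ?_
  · rintro m σ' ⟨_, _, h, _⟩; omega
  · rintro m σ' ⟨hs, hle, hm, hlen, hmem, hidx, hlev⟩ he
    have e0 := hs 0 (by decide)
    have e1 := hs 1 (by decide)
    have hlt : σ' 9 0 < n := by
      by_contra hc
      simp [Expr.eval, e0, hσ, hc] at he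
    obtain ⟨v, hv⟩ : ∃ v : Fin n, σ' 9 0 = v := ⟨⟨_, hlt⟩, rfl⟩
    have hlev' : ∀ z : Fin n, (z : ℕ) < v + 1 → update (σ' 4) v (n + 3) z = n + 3 := by
      intro z hz
      rcases Nat.lt_succ_iff_lt_or_eq.1 hz with hz | hz
      · rw [update_of_ne (by omega)]; exact hlev z (by omega)
      · rw [hz, update_self]
    refine .seq (.branch (by decide) (by omega) (fun h1 => ?_) (fun h1 => ?_))
    · have hvS : v ∈ S := by simpa [Expr.eval, hv, e1, hS, output] using h1
      refine .seq (.write (by decide) (by omega) (.write (by decide) (by omega)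
        (.seq (.write (by decide) (by omega) (.write (by decide) (by omega) ?_)))))
      refine ⟨(((hs.store _ _ (by decide)).store _ _ (by decide)).store _ _ (by decide)).store _ _
        (by decide), ?_⟩
      simp only [Expr.eval, Mem.store_same, Mem.store_ne, ne_eq, Nat.reduceEqDiff,
        not_false_eq_true, update_self, hv, e0, hσ, OfNat.zero_ne_ofNat]
      refine ⟨by omega, by omega, ?_, ?_, ?_, hlev'⟩
      · have e : {z : Fin n | z ∈ S ∧ (z : ℕ) < v + 1} =
            insert v {z : Fin n | z ∈ S ∧ (z : ℕ) < v} := by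
          ext z
          simp only [mem_ofPred_eq, mem_insert_iff, Fin.ext_iff]
          constructor
          · rintro ⟨hz, hz'⟩
            by_cases e : (z : ℕ) = v
            · exact Or.inl e
            · exact Or.inr ⟨hz, by omega⟩
          · rintro (hz | hz)
            · obtain rfl := Fin.ext hz
              exact ⟨hvS, by omega⟩
            · exact ⟨hz.1, by omega⟩
        rw [e, ncard_insert_of_notMem (by simp) (toFinite _), hlen, hv]
      · intro i hi
        by_cases e : i = σ' 3 0
        · exact ⟨v, hvS, by rw [e, update_self]⟩
        · rw [update_of_ne e]; exact hmem i (by omega)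
      · intro z hz hzv
        by_cases e : (z : ℕ) = v
        · exact ⟨σ' 3 0, by omega, by rw [update_self, e]⟩
        · obtain ⟨i, hi, hiz⟩ := hidx z hz (by omega)
          exact ⟨i, by omega, by rwa [update_of_ne (by omega)]⟩
    · have hvS : v ∉ S := by simpa [Expr.eval, hv, e1, hS, output] using h1
      refine .skip (by omega) (.seq (.write (by decide) (by omega)
        (.write (by decide) (by omega) ?_)))
      refine ⟨(hs.store _ _ (by decide)).store _ _ (by decide), ?_⟩
      simp only [Expr.eval, Mem.store_same, Mem.store_ne, ne_eq, Nat.reduceEqDiff,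
        not_false_eq_true, update_self, hv, e0, hσ]
      have e : ∀ z ∈ S, (z : ℕ) < v + 1 ↔ (z : ℕ) < v := fun z hz => by
        have : (z : ℕ) ≠ v := by
          intro e
          obtain rfl := Fin.ext e
          exact hvS hz
        omega
      refine ⟨by omega, by omega, ?_, hmem, ?_, hlev'⟩
      · rw [hlen, hv]
        congr 1
        ext z
        exact and_congr_right fun hz => (e z hz).symm
      · intro z hz hzv
        exact hidx z hz (by rw [hv]; exact (e z hz).1 hzv)
  · rintro m σ' ⟨hs, hle, hm, hlen, hmem, hidx, hlev⟩ he
    have hend : σ' 9 0 = n := by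
      by_contra hc
      have : σ' 9 0 < n := by omega
      simp [Expr.eval, hs 0 (by decide), hσ, this] at he
    rw [hend] at hlen hidx hlev
    refine hQ _ _ (by omega) hs ⟨?_, ?_, hmem, fun v hv => hidx v hv v.2⟩ fun v => hlev v v.2
    · rw [hs 0 (by decide), hσ]
    · rw [hlen]; simp
  · refine ⟨(Same.store (Same.store (fun _ _ => rfl) _ _ (by decide)) _ _ (by decide)), ?_⟩
    simp only [Expr.eval, Mem.store_same, Mem.store_ne, ne_eq, Nat.reduceEqDiff,
      not_false_eq_true, update_self]
    refine ⟨by omega, by omega, by simp, ?_, ?_, ?_⟩ <;> intros <;> omega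

/-- Enlarge the current common independent set by one element, if possible. -/
def phase : Cmd := .seq gather <| .seq breadthFirst <| .branch (var 11) augment .skip

/-- A bound on the credits spent on a common independent set of size `p` if there is one of
size `r`. -/
def phaseCost (n r p : ℕ) : ℕ := (depth r p + 1) * (24 * n + 30) + (5 * Nat.clog 2 p + 10) * p

theorem runs_phase (hE : ∀ j, (M j).E = univ) (hI : ∀ j, (M j).Indep I) (hσ : σ 0 0 = n)
    (hS : ∀ j, (M j).Indep (output n σ)) (hw : 5 * (output n σ).ncard + 4 ≤ w)
    (hU : phaseCost n I.ncard (output n σ).ncard + R ≤ U + 1)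
    (hQ : ∀ m σ', R ≤ m → σ' 0 0 = n → (∀ j, (M j).Indep (output n σ')) →
      (σ' 11 0 = 0 ∧ (output n σ').ncard = (output n σ).ncard ∧ I.ncard ≤ (output n σ).ncard) ∨
        (σ' 11 0 = 1 ∧ (output n σ').ncard = (output n σ).ncard + 1) → Q m σ') :
    Runs M w 1 phase σ U Q := by
  set S := output n σ with hSdef
  have hSn : S.ncard ≤ n := by simpa using ncard_le_card S
  have hD := depth_le I.ncard S.ncard
  rw [phaseCost] at hU
  set D := depth I.ncard S.ncard with hDdef
  -- The terms pay for augmentation, for the rounds of the search, and for listing `S` with the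
  -- remaining overhead.
  have hcost : (6 * S.ncard + 6) * D + (D + 1) * (12 * n + 5) + (6 * n + 20) ≤
      (D + 1) * (24 * n + 30) := by
    have := Nat.mul_le_mul_right D (show 6 * S.ncard + 6 ≤ 6 * n + 6 by omega)
    nlinarith
  refine .seq (runs_gather (R := (5 * Nat.clog 2 S.ncard + 10) * S.ncard +
      (D + 1) * (12 * n + 5) + ((6 * S.ncard + 6) * D + 10) + R) hσ (by omega) ?_)
  intro m₁ σ₁ hm₁ hs₁ hL₁ hlev₁
  refine .seq (runs_breadthFirst (R := (6 * S.ncard + 6) * D + 6 + R) hE hS hI hw hL₁ ?_ hlev₁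
    (by rw [← hDdef]; omega) ?_)
  · intro v
    rw [hs₁ 1 (by decide)]
    rfl
  rintro m₂ σ₂ hm₂ (⟨hL₂, hind₂, h11, hle⟩ | hf)
  · have hout : output n σ₂ = S := ext hind₂
    refine .branch (by decide) (by omega) (fun hc => absurd h11 (by simpa [Expr.eval] using hc))
      (fun _ => .skip (by omega) (hQ _ _ (by omega) hL₂.size ?_ (Or.inl ⟨h11, ?_, hle⟩)))
    · rwa [hout]
    · rw [hout]
  · refine .branch (by decide) (by omega) (fun _ => ?_)
      (fun hc => absurd hf.flag (by simp only [Expr.eval] at hc; omega))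
    exact runs_augment (D := D) (R := R) hE hS hw (by omega) hf (by omega)
      fun m σ' hm h0 h11 hi hc => hQ m σ' hm h0 hi (Or.inr ⟨h11, hc⟩)

/-- The matroid intersection algorithm. -/
def intersection : Cmd := .seq (assign 11 (.const 1)) <| .loop (var 11) phase

theorem runs_intersection (hE : ∀ j, (M j).E = univ) (hI : ∀ j, (M j).Indep I)
    (hmax : ∀ J, (∀ j, (M j).Indep J) → J.ncard ≤ I.ncard) :
    Runs M (5 * I.ncard + 4) 1 intersection (input n)
      (∑ p ∈ Finset.range (I.ncard + 1), phaseCost n I.ncard p + 2)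
      fun _ σ' => (∀ j, (M j).Indep (output n σ')) ∧ (output n σ').ncard = I.ncard := by
  refine .seq (.write (by decide) (by omega) ?_)
  -- The credits left cover every size from the current one to the maximum; the term at the maximum
  -- pays for the last phase, which finds no path.
  refine .loop (fun m σ' => σ' 0 0 = n ∧ (∀ j, (M j).Indep (output n σ')) ∧
    ((σ' 11 0 = 0 ∧ (output n σ').ncard = I.ncard ∧ 1 ≤ m) ∨
      (σ' 11 0 = 1 ∧
        ∑ p ∈ Finset.Ico (output n σ').ncard (I.ncard + 1), phaseCost n I.ncard p + 1 ≤ m)))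
    (by decide) ?_ ?_ ?_ ?_
  · rintro m σ' ⟨_, _, h | h⟩ <;> omega
  · rintro m σ' ⟨h0, hi, h | ⟨h11, hm⟩⟩ he
    · exact absurd h.1 (by simpa [Expr.eval] using he)
    · have hle := hmax _ hi
      rw [Finset.sum_eq_sum_Ico_succ_bot (by omega)] at hm
      have hpos : 30 ≤ phaseCost n I.ncard (output n σ').ncard := by
        unfold phaseCost; nlinarith
      refine runs_phase (R := ∑ p ∈ Finset.Ico ((output n σ').ncard + 1) (I.ncard + 1),
        phaseCost n I.ncard p + 1) hE hI h0 hi (by omega) (by omega) ?_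
      rintro m₁ σ₁ hm₁ h0₁ hi₁ (⟨h, h', hle'⟩ | ⟨h, h'⟩)
      · exact ⟨h0₁, hi₁, Or.inl ⟨h, by omega, by omega⟩⟩
      · exact ⟨h0₁, hi₁, Or.inr ⟨h, by rw [h']; omega⟩⟩
  · rintro m σ' ⟨h0, hi, h | h⟩ he
    · exact ⟨hi, h.2.1⟩
    · exact absurd (show σ' 11 0 = 0 by simpa [Expr.eval] using he) (by omega)
  · have hout : output n ((input n).store 11 ((Expr.const 0).eval (input n))
        ((Expr.const 1).eval (input n))) = ∅ := by
      ext v; simp [output, Mem.store_ne, input]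
    rw [hout]
    refine ⟨by simp [Mem.store_ne, input], fun j => (M j).empty_indep, Or.inr ⟨?_, ?_⟩⟩
    · simp [Expr.eval, Mem.store_same]
    · rw [ncard_empty, ← Finset.range_eq_Ico]
      omega

end OracleRAM

/-! ### Summing the costs -/

open OracleRAM

/-- For `p < r` the summand is at most `p / (r - p) + 1 = r / (r - p)`, which sums to `r` times a
harmonic number. The term `p = r` adds at most `r + 1`. -/
theorem sum_depth_le (r : ℕ) :
    ((∑ p ∈ Finset.range (r + 1), (depth r p + 1) : ℕ) : ℝ) ≤
      4 * (max (r : ℝ) 1 * max (Real.log r) 1) := by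
  have h1 : ((∑ p ∈ Finset.range r, (depth r p + 1) : ℕ) : ℝ) ≤ r * (1 + Real.log r) := by
    have hh := harmonic_le_one_add_log r
    refine le_trans ?_ (mul_le_mul_of_nonneg_left hh (Nat.cast_nonneg r))
    rw [harmonic]
    push_cast
    rw [Finset.mul_sum, ← Finset.sum_range_reflect (fun i : ℕ => (r : ℝ) * ((i : ℝ) + 1)⁻¹) r]
    refine Finset.sum_le_sum fun p hp => ?_
    rw [Finset.mem_range] at hp
    have hrp : (0 : ℝ) < (r : ℝ) - p := by
      rw [sub_pos]; exact_mod_cast hp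
    have e : ((r - 1 - p : ℕ) : ℝ) + 1 = (r : ℝ) - p := by
      rw [Nat.sub_sub, Nat.cast_sub (by omega)]; push_cast; ring
    have hd : (depth r p : ℝ) ≤ p / ((r : ℝ) - p) := by
      rw [depth, max_eq_left (by omega)]
      refine Nat.cast_div_le.trans (le_of_eq ?_)
      rw [Nat.cast_sub hp.le]
    rw [e]
    calc (depth r p : ℝ) + 1 ≤ p / ((r : ℝ) - p) + 1 := by linarith
      _ = r * ((r : ℝ) - p)⁻¹ := by field_simp; ring
  rw [Finset.sum_range_succ]
  have h2 := depth_le r r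
  have h3 : ((depth r r + 1 : ℕ) : ℝ) ≤ r + 1 := by exact_mod_cast Nat.succ_le_succ h2
  rw [Nat.cast_add]
  set A := max (r : ℝ) 1
  set L := max (Real.log r) 1
  have hA : (r : ℝ) ≤ A := le_max_left _ _
  have hA1 : 1 ≤ A := le_max_right _ _
  have hL : Real.log r ≤ L := le_max_left _ _
  have hL1 : 1 ≤ L := le_max_right _ _
  have h4 : (r : ℝ) * (1 + Real.log r) ≤ A * (2 * L) :=
    mul_le_mul hA (by linarith) (by have := Real.log_natCast_nonneg r; linarith) (by linarith)
  have h5 : A ≤ A * L := le_mul_of_one_le_right (by linarith) hL1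
  linarith

theorem clog_le (r : ℕ) : (Nat.clog 2 r : ℝ) ≤ 3 * max (Real.log r) 1 := by
  have h1 : Nat.clog 2 r ≤ Nat.log 2 r + 1 :=
    Nat.clog_le_of_le_pow (Nat.lt_pow_succ_log_self (by decide) r).le
  have h2 : (Nat.log 2 r : ℝ) ≤ Real.log r / Real.log 2 := by
    have := Real.natLog_le_logb r 2
    simpa [Real.logb] using this
  have h3 : Real.log r / Real.log 2 ≤ 2 * Real.log r := by
    rw [div_le_iff₀ (Real.log_pos (by norm_num))]
    nlinarith [Real.log_two_gt_d9, Real.log_natCast_nonneg r]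
  have h4 : (Nat.clog 2 r : ℝ) ≤ Nat.log 2 r + 1 := by exact_mod_cast h1
  linarith [le_max_left (Real.log r) 1, le_max_right (Real.log r) 1]

theorem sum_phaseCost_le {n r : ℕ} (hr : r ≤ n) :
    ((∑ p ∈ Finset.range (r + 1), phaseCost n r p + 2 : ℕ) : ℝ) ≤ 300 * nrLogR n r := by
  have h1 : ∑ p ∈ Finset.range (r + 1), phaseCost n r p ≤
      (∑ p ∈ Finset.range (r + 1), (depth r p + 1)) * (24 * n + 30) +
        (r + 1) * ((5 * Nat.clog 2 r + 10) * r) := by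
    simp only [phaseCost, Finset.sum_add_distrib (f := fun p => (depth r p + 1) * (24 * n + 30)),
      Finset.sum_mul]
    refine Nat.add_le_add_left ?_ _
    refine (Finset.sum_le_card_nsmul _ _ ((5 * Nat.clog 2 r + 10) * r) fun p hp => ?_).trans ?_
    · have hp' : p ≤ r := by rw [Finset.mem_range] at hp; omega
      have := Nat.clog_mono_right 2 hp'
      exact Nat.mul_le_mul (by omega) hp'
    · simp
  have h2 := sum_depth_le r
  have h3 := clog_le r
  have h1' : ((∑ p ∈ Finset.range (r + 1), phaseCost n r p : ℕ) : ℝ) ≤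
      ((∑ p ∈ Finset.range (r + 1), (depth r p + 1) : ℕ) : ℝ) * (24 * n + 30) +
        (r + 1) * ((5 * Nat.clog 2 r + 10) * r) := by exact_mod_cast h1
  rw [nrLogR]
  have hrn : (r : ℝ) ≤ max (n : ℝ) 1 := le_trans (by exact_mod_cast hr) (le_max_left _ _)
  set A := max (r : ℝ) 1
  set L := max (Real.log r) 1
  set B := max (n : ℝ) 1
  have hA : (r : ℝ) ≤ A := le_max_left _ _
  have hA1 : 1 ≤ A := le_max_right _ _
  have hL1 : 1 ≤ L := le_max_right _ _
  have hB : (n : ℝ) ≤ B := le_max_left _ _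
  have hB1 : 1 ≤ B := le_max_right _ _
  -- The rounds contribute `4 * 54 = 216` and the binary searches `2 * 25 = 50`; for the latter one
  -- factor `r` is replaced by `n`.
  have h4 : ((∑ p ∈ Finset.range (r + 1), (depth r p + 1) : ℕ) : ℝ) * (24 * n + 30) ≤
      4 * (A * L) * (54 * B) :=
    mul_le_mul h2 (by linarith) (by positivity) (by positivity)
  have h5 : ((r : ℝ) + 1) * ((5 * Nat.clog 2 r + 10) * r) ≤ (2 * A) * ((25 * L) * B) := by
    refine mul_le_mul (by linarith) (mul_le_mul (by linarith) hrn (by positivity) (by positivity))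
      (by positivity) (by positivity)
  have h6 : 1 ≤ B * A * L := by
    have := one_le_mul_of_one_le_of_one_le hB1 hA1
    exact one_le_mul_of_one_le_of_one_le this hL1
  push_cast at h1' h4 ⊢
  nlinarith

theorem theorem1 :
    ∃ (P : OracleRAM.Cmd) (C : ℝ), 0 < C ∧
      ∀ (n : ℕ) (M₁ M₂ : Matroid (Fin n)), M₁.E = Set.univ → M₂.E = Set.univ →
      ∀ r : ℕ,
        IsGreatest {m : ℕ | ∃ I : Set (Fin n), M₁.Indep I ∧ M₂.Indep I ∧ I.ncard = m} r →
        ∃ (σ : OracleRAM.Mem) (k : OracleRAM.Cost),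
          OracleRAM.Exec ![M₁, M₂] P (OracleRAM.input n) σ k ∧
          M₁.Indep (OracleRAM.output n σ) ∧ M₂.Indep (OracleRAM.output n σ) ∧
          (OracleRAM.output n σ).ncard = r ∧
          (k.queries : ℝ) ≤ C * nrLogR n r ∧
          ∀ T₁ T₂ : ℝ, 0 ≤ T₁ → 0 ≤ T₂ → max (r : ℝ) 1 ≤ T₁ + T₂ →
            k.time T₁ T₂ ≤ C * (nrLogR n r * (T₁ + T₂)) := by
  -- A credit is worth `160 * (r + 1) ≤ 320 * (T₁ + T₂)` steps and one query, and there are at most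
  -- `300 * nrLogR n r` credits, so `321 * 300` would suffice.
  refine ⟨intersection, 100000, by norm_num, ?_⟩
  rintro n M₁ M₂ hE₁ hE₂ r ⟨⟨I, hI₁, hI₂, rfl⟩, hmax⟩
  have hrn : I.ncard ≤ n := by simpa using ncard_le_card I
  obtain ⟨σ, k, m, hexec, hsteps, hqueries, -, hind, hcard⟩ :=
    runs_intersection (M := ![M₁, M₂]) (I := I) (Fin.forall_fin_two.2 ⟨hE₁, hE₂⟩)
      (Fin.forall_fin_two.2 ⟨hI₁, hI₂⟩) (fun J hJ => hmax ⟨J, hJ 0, hJ 1, rfl⟩)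
  have hU := sum_phaseCost_le hrn
  set U := ∑ p ∈ Finset.range (I.ncard + 1), phaseCost n I.ncard p + 2
  have hpos : 0 ≤ nrLogR n I.ncard := by unfold nrLogR; positivity
  have hq : k.2.1 + k.2.2 ≤ U := by omega
  have hs : k.1 ≤ 32 * (5 * I.ncard + 4 + 1) * U := by omega
  have hq' : (k.2.1 : ℝ) + k.2.2 ≤ U := by exact_mod_cast hq
  have hs' : (k.1 : ℝ) ≤ 32 * (5 * I.ncard + 4 + 1) * U := by exact_mod_cast hs
  refine ⟨σ, k, hexec, hind 0, hind 1, hcard, ?_, fun T₁ T₂ hT₁ hT₂ hT => ?_⟩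
  · rw [Cost.queries]
    push_cast
    linarith
  · rw [Cost.time]
    have h1 : (I.ncard : ℝ) ≤ T₁ + T₂ := (le_max_left _ _).trans hT
    have h2 : (1 : ℝ) ≤ T₁ + T₂ := (le_max_right _ _).trans hT
    have h3 : 32 * (5 * (I.ncard : ℝ) + 4 + 1) * U ≤ (320 * (T₁ + T₂)) * U :=
      mul_le_mul_of_nonneg_right (by linarith) (Nat.cast_nonneg U)
    have h4 : (k.2.1 : ℝ) * T₁ + k.2.2 * T₂ ≤ ((k.2.1 : ℝ) + k.2.2) * (T₁ + T₂) := by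
      have := mul_nonneg (Nat.cast_nonneg (α := ℝ) k.2.1) hT₂
      have := mul_nonneg (Nat.cast_nonneg (α := ℝ) k.2.2) hT₁
      linarith
    have h5 : ((k.2.1 : ℝ) + k.2.2) * (T₁ + T₂) ≤ U * (T₁ + T₂) :=
      mul_le_mul_of_nonneg_right hq' (by linarith)
    have h6 : (U : ℝ) * (T₁ + T₂) ≤ 300 * nrLogR n I.ncard * (T₁ + T₂) :=
      mul_le_mul_of_nonneg_right hU (by linarith)
    have h7 : 0 ≤ nrLogR n I.ncard * (T₁ + T₂) := mul_nonneg hpos (by linarith)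
    linarith
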